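/- An instance consists of a finite set $C$ of candidates, a finite multiset $V$ of votes $v\subseteq C$ (the set of candidates that the voter approves), a nonempty set $J\subseteq C$ of distinguished candidates, and positive integers $k\le |C|$ and $\ell\le |V|$. Under approval voting (AV), a committee $w\subseteq C$ has score $\sum_{v\in V}|v\cap w|$, and the winning $k$-committees are the $k$-element subsets of $C$ of maximum score. For a fixed integer $r\ge 0$, the problem $r$-Bounded Destructive Vote-Deletion-Change Bribery for AV asks whether there is a subset $V'\subseteq V$ of at most $\ell$ votes such that each vote $v\in V'$ can be replaced by a vote $v'\subsetneq v$ (that is, one or more candidates are removed from $v$) of Hamming distance $|v\setminus v'|+|v'\setminus v|\le r$ from $v$ so that afterwards no candidate of $J$ belongs to any winning $k$-committee. **Theorem.** For $r=1$, this problem is solvable in polynomial time: there are a random access machine (with unit-cost addition, truncated subtraction and indirect memory access, and no multiplication) and a polynomial $p$ such that, on every instance, encoded as a binary word $x$, the machine halts after at most $p(|x|)$ steps and accepts if and only if the answer is yes. -/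

import Mathlib

/-! ### Polynomial time: random access machines with a step count

The machine is the classical random access machine with finitely many registers in use, an
unbounded random access memory of natural numbers, and the operations "constant, addition,
truncated subtraction, indirect load, indirect store", each performed in one step.
There is no multiplication (nor any other operation that more than doubles the largest number
present), so that numbers have linearly many bits in the number of steps and unit cost is
polynomially equivalent to multitape Turing machines. -/

namespace RAM

/-- The operations of the machine; the arguments are names of registers, except for the
literal `a` in `const x a`. -/
inductive Op : Type
  /-- `x := a` -/
  | const (x a : ℕ)
  /-- `x := y + z` -/
  | add (x y z : ℕ)
  /-- `x := y - z` (truncated at zero) -/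
  | sub (x y z : ℕ)
  /-- `x := mem[y]` -/
  | load (x y : ℕ)
  /-- `mem[x] := y` -/
  | store (x y : ℕ)

/-- Programs: straight-line operations, sequencing, branching and looping on whether a
register is zero. -/
inductive Prog : Type
  /-- do nothing -/
  | skip
  /-- perform one operation -/
  | op (o : Op)
  /-- first `p`, then `q` -/
  | seq (p q : Prog)
  /-- if register `x` is nonzero then `p` else `q` -/
  | ite (x : ℕ) (p q : Prog)
  /-- while register `x` is nonzero do `p` -/
  | loop (x : ℕ) (p : Prog)

/-- The contents of the registers and of the memory. -/
structure Store : Type where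
  reg : ℕ → ℕ
  mem : ℕ → ℕ

/-- The effect of one operation. -/
def Op.apply (s : Store) : Op → Store
  | .const x a => { s with reg := Function.update s.reg x a }
  | .add x y z => { s with reg := Function.update s.reg x (s.reg y + s.reg z) }
  | .sub x y z => { s with reg := Function.update s.reg x (s.reg y - s.reg z) }
  | .load x y => { s with reg := Function.update s.reg x (s.mem (s.reg y)) }
  | .store x y => { s with mem := Function.update s.mem (s.reg x) (s.reg y) }

/-- A configuration: the list of program parts still to be executed, in this order, and the
current store. -/
structure Config : Type where
  todo : List Prog
  store : Store

/-- One step of the machine. A configuration with nothing left to do has halted and stays as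
it is. -/
def step : Config → Config
  | ⟨[], s⟩ => ⟨[], s⟩
  | ⟨.skip :: K, s⟩ => ⟨K, s⟩
  | ⟨.op o :: K, s⟩ => ⟨K, o.apply s⟩
  | ⟨.seq p q :: K, s⟩ => ⟨p :: q :: K, s⟩
  | ⟨.ite x p q :: K, s⟩ => ⟨(if s.reg x = 0 then q else p) :: K, s⟩
  | ⟨.loop x p :: K, s⟩ => ⟨if s.reg x = 0 then K else p :: .loop x p :: K, s⟩

/-- The start of program `P` on the input word `w`: memory cell `i` holds the `i`-th bit of `w`
(and `0` beyond the end of `w`), register `0` holds the length of `w`, and every other register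
holds `0`. -/
def start (P : Prog) (w : List Bool) : Config where
  todo := [P]
  store :=
    { reg := fun x => if x = 0 then w.length else 0
      mem := fun i => (w.getD i false).toNat }

/-- The configuration has halted. -/
def Config.Halted (c : Config) : Prop := c.todo = []

/-- A halted configuration accepts if register `0` holds a nonzero number, and rejects
otherwise. -/
def Config.Accepts (c : Config) : Prop := c.store.reg 0 ≠ 0

/-- The decision problem with instances `α`, encoded as binary words by `enc`, and yes-instances
`L` is solvable in polynomial time: a single program halts, on every instance, within a number
of steps that is bounded by a fixed polynomial in the length of the encoded instance, and gives
the correct answer. -/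
def SolvableInPolyTime {α : Type} (enc : α → List Bool) (L : α → Prop) : Prop :=
  ∃ (P : Prog) (p : Polynomial ℕ), ∀ a : α,
    (step^[p.eval (enc a).length] (start P (enc a))).Halted ∧
    ((step^[p.eval (enc a).length] (start P (enc a))).Accepts ↔ L a)

end RAM

/-! ### Approval-based multi-winner voting

A vote is the set of approved candidates; the multiset of votes is a family indexed by the
voters. -/

namespace ApprovalVoting

section Rules

variable {C ι : Type} [DecidableEq C] [Fintype ι]

/-- The AV score of a committee `w` in the election with votes `V`. -/
def avScore (V : ι → Finset C) (w : Finset C) : ℕ := ∑ i, (V i ∩ w).card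

/-- `w` is a winning `k`-committee under AV: it has the largest score of all `k`-committees. -/
def IsWinningAV (V : ι → Finset C) (k : ℕ) (w : Finset C) : Prop :=
  w.card = k ∧ ∀ w' : Finset C, w'.card = k → avScore V w' ≤ avScore V w

/-- The Hamming distance of two votes. -/
def voteDist (v v' : Finset C) : ℕ := (v \ v').card + (v' \ v).card

/-- The vote `v'` results from the (necessarily nonempty) vote `v` by a single vote deletion
change, that is, by removing one or more candidates, and has distance at most `r` from `v`. -/
def IsVDC (r : ℕ) (v v' : Finset C) : Prop := v' ⊂ v ∧ voteDist v v' ≤ r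

end Rules

/-- Instances of destructive bribery problems with vote-level operations, with candidates
`Fin m` and voters `Fin n`. -/
structure BriberyInstance : Type where
  /-- the number of candidates -/
  m : ℕ
  /-- the number of votes -/
  n : ℕ
  /-- the votes -/
  vote : Fin n → Finset (Fin m)
  /-- the distinguished candidates -/
  J : Finset (Fin m)
  J_nonempty : J.Nonempty
  /-- the size of the committees -/
  k : ℕ
  k_pos : 0 < k
  k_le : k ≤ m
  /-- the number of votes that may be changed -/
  l : ℕ
  l_pos : 0 < l
  l_le : l ≤ n

/-- Yes-instances of `r`-bounded destructive vote deletion change bribery for AV. -/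
def IsYesVDC (r : ℕ) (I : BriberyInstance) : Prop :=
  ∃ (V' : Finset (Fin I.n)) (W : Fin I.n → Finset (Fin I.m)),
    V'.card ≤ I.l ∧
    (∀ i ∈ V', IsVDC r (I.vote i) (W i)) ∧
    (∀ i ∉ V', W i = I.vote i) ∧
    ∀ w : Finset (Fin I.m), IsWinningAV W I.k w → ∀ c ∈ I.J, c ∉ w

/-- Unary code of a number, terminated by `false`. -/
def unaryCode (a : ℕ) : List Bool := List.replicate a true ++ [false]

/-- The characteristic word of a set of candidates. -/
def setCode {m : ℕ} (S : Finset (Fin m)) : List Bool := List.ofFn fun c => decide (c ∈ S)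

/-- The binary word that describes an instance: the numbers `m`, `n`, `k`, `l`, then the set of
distinguished candidates and the votes, one after the other. As `k ≤ m` and `l ≤ n`, and every
candidate and every vote is listed anyway, writing these numbers in unary changes the length at
most by a constant factor. -/
def BriberyInstance.encode (I : BriberyInstance) : List Bool :=
  unaryCode I.m ++ unaryCode I.n ++ unaryCode I.k ++ unaryCode I.l ++
    setCode I.J ++ (List.ofFn fun i => setCode (I.vote i)).flatten

end ApprovalVoting

/-! With distance bound one, bribing a vote means removing exactly one candidate from it. Since
$k\le|C|$, a candidate lies in no winning $k$-committee iff at least $k$ candidates have strictly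
more approvals (`forall_winning_notMem_iff`). Required for all of $J$, this can be tested on rivals
outside $J$ only (`forall_winning_iff`). Removals outside $J$ never help, so the rivals may be
assumed to keep their approvals. The goal is then that every $c\in J$ falls below the threshold
$\tau$, the $k$-th largest number of approvals outside $J$ (zero if there are fewer than $k$ such
candidates). Hence an instance is a yes-instance iff at most $\ell$ voters can be assigned, each to
one approved candidate of $J$, so that every $c\in J$ receives more than $\mathrm{score}(c)-\tau$
voters (`isYes_iff`).

This degree-constrained assignment is solved by an auction. All voters start at price 0. While some
$c\in J$ has a current score of at least $\tau$, it takes a cheapest voter among those approving it,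
possibly from another owner, and the price of that voter rises by one. `Data.Inv` records that no
owner holds more voters than it needs and that a sold voter costs at most one more than any voter
approving its owner; `Data.Inv.bid` preserves it. If everyone is satisfied, the sold voters form a
solution of least size (`Data.Inv.isSolution`, `Data.Inv.card_sold_le`). If some $c$ sees only
prices above $n$, there is a price level that no voter has, and the voters above it witness a
violation of Hall's condition (`Data.Inv.no_solution`). Prices stay at most $n+1$, so there are at
most $n(n+1)$ bids.

The machine part implements this procedure and proves its correctness and step count together, with
the predicate `Within` as a Hoare logic with a time budget. -/

namespace RAM

/-! ### A program logic with step counts -/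

/-- Started in `s`, the program `P` finishes within `t` steps in a store that satisfies `Q`. -/
def Within (P : Prog) (t : ℕ) (s : Store) (Q : Store → Prop) : Prop :=
  ∃ t' ≤ t, ∃ s', Q s' ∧ ∀ K, step^[t'] ⟨P :: K, s⟩ = ⟨K, s'⟩

/-- The straight-line program that performs a list of operations. -/
def block : List Op → Prog
  | [] => .skip
  | o :: ops => .seq (.op o) (block ops)

theorem Within.mono {P : Prog} {t t' : ℕ} {s : Store} {Q Q' : Store → Prop}
    (h : Within P t s Q) (ht : t ≤ t') (hQ : ∀ s', Q s' → Q' s') : Within P t' s Q' := by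
  obtain ⟨u, hu, s', h1, h2⟩ := h
  exact ⟨u, hu.trans ht, s', hQ _ h1, h2⟩

theorem Within.skip {s : Store} {Q : Store → Prop} {t : ℕ} (ht : 1 ≤ t) (h : Q s) :
    Within .skip t s Q :=
  ⟨1, ht, s, h, fun _ => rfl⟩

/-- `Within` quantifies over the remaining program `K`, so the run of `P` can be used with `P' :: K`
as the rest. The extra step unpacks the sequence. -/
theorem Within.seq {P P' : Prog} {t t' : ℕ} {s : Store} {Q : Store → Prop}
    (h : Within P t s fun s' => Within P' t' s' Q) : Within (.seq P P') (t + t' + 1) s Q := by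
  obtain ⟨u, hu, s', ⟨u', hu', s'', hq, h2⟩, h1⟩ := h
  refine ⟨u' + u + 1, by omega, s'', hq, fun K => ?_⟩
  rw [Function.iterate_succ_apply, Function.iterate_add_apply]
  change step^[u'] (step^[u] ⟨P :: P' :: K, s⟩) = _
  rw [h1, h2]

theorem Within.seq_le {P P' : Prog} {T : ℕ} (t t' : ℕ) (ht : t + t' + 1 ≤ T) {s : Store}
    {Q : Store → Prop} (h : Within P t s fun s' => Within P' t' s' Q) :
    Within (.seq P P') T s Q :=
  h.seq.mono ht fun _ h => h

theorem Within.ite {x : ℕ} {P P' : Prog} {t : ℕ} {s : Store} {Q : Store → Prop}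
    (h1 : s.reg x ≠ 0 → Within P t s Q) (h2 : s.reg x = 0 → Within P' t s Q) :
    Within (.ite x P P') (t + 1) s Q := by
  by_cases hx : s.reg x = 0
  · obtain ⟨u, hu, s', hq, h⟩ := h2 hx
    refine ⟨u + 1, by omega, s', hq, fun K => ?_⟩
    rw [Function.iterate_succ_apply, ← h K]
    simp [step, hx]
  · obtain ⟨u, hu, s', hq, h⟩ := h1 hx
    refine ⟨u + 1, by omega, s', hq, fun K => ?_⟩
    rw [Function.iterate_succ_apply, ← h K]
    simp [step, hx]

/-- A loop whose invariant carries a variant that decreases in each round. -/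
theorem Within.loop {x : ℕ} {P : Prog} {T : ℕ} (Inv : ℕ → Store → Prop)
    (hP : ∀ v s, Inv v s → s.reg x ≠ 0 → Within P T s fun s' => ∃ v' < v, Inv v' s')
    {v : ℕ} {s : Store} (hs : Inv v s) :
    Within (.loop x P) (v * (T + 1) + 1) s fun s' => s'.reg x = 0 ∧ ∃ v', Inv v' s' := by
  induction v using Nat.strong_induction_on generalizing s with
  | _ v ih =>
    by_cases hx : s.reg x = 0
    · exact ⟨1, by omega, s, ⟨hx, v, hs⟩, fun K => by simp [step, hx]⟩
    · obtain ⟨u, hu, s', ⟨v', hv', hs'⟩, h1⟩ := hP v s hs hx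
      obtain ⟨u', hu', s'', hq, h2⟩ := ih v' hv' hs'
      refine ⟨u' + u + 1, ?_, s'', hq, fun K => ?_⟩
      · have : (v' + 1) * (T + 1) ≤ v * (T + 1) := Nat.mul_le_mul_right _ hv'
        rw [Nat.add_mul] at this
        omega
      · rw [Function.iterate_succ_apply, Function.iterate_add_apply]
        have : step ⟨Prog.loop x P :: K, s⟩ = ⟨P :: .loop x P :: K, s⟩ := by simp [step, hx]
        rw [this, h1, h2]

/-- A loop that is controlled by a register counting down from `n`. -/
theorem Within.for {x : ℕ} {P : Prog} {T n : ℕ} (Inv : ℕ → Store → Prop)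
    (hx : ∀ j s, Inv j s → s.reg x = n - j)
    (hP : ∀ j s, j < n → Inv j s → Within P T s (Inv (j + 1)))
    {s : Store} (hs : Inv 0 s) :
    Within (.loop x P) (n * (T + 1) + 1) s (Inv n) := by
  have := Within.loop (x := x) (P := P) (T := T)
    (fun v s => ∃ j ≤ n, v = n - j ∧ Inv j s) (s := s) (v := n) ?_ ⟨0, by simp, by simp, hs⟩
  · refine this.mono le_rfl ?_
    rintro s' ⟨h0, v, j, hj, hv, hi⟩
    have := hx j s' hi
    obtain rfl : j = n := by omega
    exact hi
  · rintro v s ⟨j, hj, rfl, hi⟩ h0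
    have := hx j s hi
    exact (hP j s (by omega) hi).mono le_rfl fun s' h =>
      ⟨n - (j + 1), by omega, j + 1, by omega, rfl, h⟩

theorem iterate_step_halted (t : ℕ) (s : Store) : step^[t] ⟨[], s⟩ = ⟨[], s⟩ := by
  induction t with
  | zero => rfl
  | succ t ih => rw [Function.iterate_succ_apply]; exact ih

/-- A program that gives the right answer within polynomially many steps solves the problem. -/
theorem SolvableInPolyTime.of_within {α : Type} {enc : α → List Bool} {L : α → Prop}
    (P : Prog) (p : Polynomial ℕ)
    (h : ∀ a, Within P (p.eval (enc a).length) (start P (enc a)).store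
      fun s => s.reg 0 ≠ 0 ↔ L a) : SolvableInPolyTime enc L := by
  refine ⟨P, p, fun a => ?_⟩
  obtain ⟨t, ht, s', hq, h1⟩ := h a
  have h2 : step^[p.eval (enc a).length] (start P (enc a)) = ⟨[], s'⟩ := by
    obtain ⟨d, hd⟩ := Nat.exists_eq_add_of_le' ht
    rw [hd, Function.iterate_add_apply]
    have := h1 []
    change step^[t] (start P (enc a)) = _ at this
    rw [this, iterate_step_halted]
  rw [h2]
  exact ⟨rfl, hq⟩

end RAM

/-! ### An auction for degree-constrained assignments -/

namespace Auction

/-- Voters `i < n`, items `c`; `A i c` says that voter `i` may be assigned to `c`. -/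
structure Data where
  n : ℕ
  A : ℕ → ℕ → Prop
  J : ℕ → Prop
  score : ℕ → ℕ
  τ : ℕ

variable (d : Data)

/-- A partial assignment of voters such that the score of every item of `J`, diminished by the
number of voters assigned to it, is below the threshold. -/
def Data.IsSolution (D : Finset ℕ) (g : ℕ → ℕ) : Prop :=
  D ⊆ Finset.range d.n ∧ (∀ i ∈ D, d.A i (g i) ∧ d.J (g i)) ∧
    ∀ c, d.J c → d.score c < d.τ + (D.filter fun i => g i = c).card

/-- The voters that have been sold. -/
def Data.sold (p : ℕ → ℕ) : Finset ℕ := (Finset.range d.n).filter fun i => p i ≠ 0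

/-- The invariant of the auction with prices `p`, owners `o`, and current scores `r`. -/
structure Data.Inv (p o r : ℕ → ℕ) : Prop where
  owner : ∀ i < d.n, p i ≠ 0 → d.A i (o i) ∧ d.J (o i)
  price : ∀ i < d.n, p i ≠ 0 → ∀ j < d.n, d.A j (o i) → p i ≤ p j + 1
  score : ∀ c, d.J c → r c + ((d.sold p).filter fun i => o i = c).card = d.score c
  tight : ∀ i < d.n, p i ≠ 0 → d.τ ≤ r (o i) + 1

variable {d} {p o r : ℕ → ℕ}

theorem Data.mem_sold {i : ℕ} : i ∈ d.sold p ↔ i < d.n ∧ p i ≠ 0 := by simp [Data.sold]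

theorem Data.Inv.init (r : ℕ → ℕ) (hr : ∀ c, d.J c → r c = d.score c) :
    d.Inv (fun _ => 0) o r where
  owner := by simp
  price := by simp
  score := by simpa [Data.sold] using hr
  tight := by simp

/-- The scores after the owner of `i`, if any, has lost `i`. -/
def release (p o r : ℕ → ℕ) (i : ℕ) : ℕ → ℕ :=
  if p i = 0 then r else Function.update r (o i) (r (o i) + 1)

theorem Data.sold_update {i : ℕ} (hi : i < d.n) :
    d.sold (Function.update p i (p i + 1)) = insert i (d.sold p) := by
  ext j
  simp only [Data.mem_sold, Finset.mem_insert, Function.update_apply]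
  by_cases h : j = i
  · subst h; simp [hi]
  · simp [h]

/-- The price condition survives because `c` takes a cheapest voter approving it and prices never
fall. Tightness survives because `c` buys only while its score is at least `τ`, and a release only
raises scores. The previous owner of `i` may be `c` itself; then its score is unchanged and only the
price rises. -/
theorem Data.Inv.bid (h : d.Inv p o r) {c i : ℕ}
    (hs : ∀ S ⊆ Finset.range d.n, (∀ i ∈ S, d.A i c) → S.card ≤ d.score c)
    (hc : d.J c) (hr : d.τ ≤ r c) (hi : i < d.n) (hA : d.A i c)
    (hmin : ∀ j < d.n, d.A j c → p i ≤ p j) :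
    d.Inv (Function.update p i (p i + 1)) (Function.update o i c)
      (Function.update (release p o r i) c (release p o r i c - 1)) := by
  have hle : ∀ j, p j ≤ Function.update p i (p i + 1) j := by
    intro j; rw [Function.update_apply]; split_ifs with hj
    · subst hj; omega
    · rfl
  have howner : ∀ j < d.n, Function.update p i (p i + 1) j ≠ 0 →
      d.A j (Function.update o i c j) ∧ d.J (Function.update o i c j) := by
    intro j hj hp
    by_cases hji : j = i
    · subst hji; simp [hA, hc]
    · simp only [Function.update_of_ne hji] at hp ⊢
      exact h.owner j hj hp
  -- the sold voters of an item, before and after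
  have hcnt : ∀ c', ((d.sold (Function.update p i (p i + 1))).filter
        fun j => Function.update o i c j = c').card + (if p i ≠ 0 ∧ o i = c' then 1 else 0)
      = ((d.sold p).filter fun j => o j = c').card + (if c' = c then 1 else 0) := by
    intro c'
    set F := ((d.sold p).erase i).filter fun j => o j = c' with hF
    have hiF : i ∉ F := by simp [hF]
    have e1 : (d.sold (Function.update p i (p i + 1))).filter
        (fun j => Function.update o i c j = c') = if c' = c then insert i F else F := by
      rw [Data.sold_update hi]
      ext j
      by_cases hji : j = i
      · subst hji
        split_ifs with h1
        · simp [h1]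
        · simp [hiF, Ne.symm h1]
      · split_ifs <;> simp [hF, hji]
    have e2 : (d.sold p).filter (fun j => o j = c') =
        if p i ≠ 0 ∧ o i = c' then insert i F else F := by
      ext j
      by_cases hji : j = i
      · subst hji
        split_ifs with h1
        · simp [Data.mem_sold, hi, h1.1, h1.2]
        · simp only [hiF, iff_false, Finset.mem_filter, Data.mem_sold]
          tauto
      · split_ifs <;> simp [hF, hji]
    rw [e1, e2]
    split_ifs <;> simp [Finset.card_insert_of_notMem hiF]
  have hrel : ∀ c', release p o r i c' = r c' + if p i ≠ 0 ∧ o i = c' then 1 else 0 := by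
    intro c'
    unfold release
    by_cases h0 : p i = 0
    · simp [h0]
    · by_cases h1 : c' = o i
      · subst h1; simp [h0]
      · simp [h0, Function.update_of_ne h1, Ne.symm h1]
  refine ⟨howner, ?_, ?_, ?_⟩
  · intro j hj hp k hk hAk
    have := hle k
    by_cases hji : j = i
    · subst hji
      simp only [Function.update_self] at hAk ⊢
      have := hmin k hk hAk
      omega
    · simp only [Function.update_of_ne hji] at hp hAk ⊢
      have := h.price j hj hp k hk hAk
      omega
  · intro c' hc'
    have h1 := h.score c' hc'
    have h2 := hcnt c'
    have h3 := hrel c'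
    by_cases hcc : c' = c
    · subst hcc
      -- This keeps the subtraction in the new score of the buyer from truncating: if the released
      -- score were 0, which can only happen for `τ = 0`, the buyer would end up with more voters
      -- than approve it.
      have h4 : ((d.sold (Function.update p i (p i + 1))).filter
          fun j => Function.update o i c' j = c').card ≤ d.score c' := by
        refine hs _ ((Finset.filter_subset _ _).trans (Finset.filter_subset _ _)) fun j hj => ?_
        simp only [Finset.mem_filter, Data.mem_sold] at hj
        have := (howner j hj.1.1 hj.1.2).1
        rwa [hj.2] at this
      simp only [Function.update_self, if_true] at h2 h3 ⊢
      omega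
    · simp only [Function.update_of_ne hcc, if_neg hcc] at h2 ⊢
      omega
  · intro j hj hp
    by_cases hji : j = i
    · subst hji
      simp only [Function.update_self]
      have := hrel c
      omega
    · simp only [Function.update_of_ne hji] at hp ⊢
      have h1 := h.tight j hj hp
      by_cases hcc : o j = c
      · have := hrel c
        rw [hcc]; simp only [Function.update_self]; omega
      · have := hrel (o j)
        simp only [Function.update_of_ne hcc]; omega

/-- If an unsatisfied item only finds voters at a prohibitive price, there is no solution. -/
theorem Data.Inv.no_solution (h : d.Inv p o r) {c : ℕ} (hc : d.J c) (hr : d.τ ≤ r c)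
    (hp : ∀ j < d.n, d.A j c → d.n < p j) (D : Finset ℕ) (g : ℕ → ℕ) : ¬ d.IsSolution D g := by
  rintro ⟨hD, hg, hsol⟩
  classical
  -- a price level without voters, below the prices that `c` sees
  obtain ⟨L, hL1, hL2, hgap⟩ : ∃ L, 1 ≤ L ∧ (∀ j < d.n, d.A j c → L < p j) ∧
      ∀ j < d.n, p j ≠ L := by
    by_contra! hcon
    by_cases hN : ∃ j < d.n, d.A j c
    · obtain ⟨j, hj, hA⟩ := hN
      -- Pigeonhole: if all of the levels 1 to `n` were taken, they would be taken by the `n - 1`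
      -- voters other than `j`, whose own price exceeds `n`.
      have : Finset.Icc 1 (d.n + 1) ⊆
          insert (d.n + 1) (((Finset.range d.n).erase j).image p) := by
        intro L hL
        rw [Finset.mem_Icc] at hL
        by_cases hLn : L = d.n + 1
        · simp [hLn]
        · obtain ⟨i, hi, hpi⟩ := hcon L hL.1 fun j hj hA => by have := hp j hj hA; omega
          refine Finset.mem_insert_of_mem (Finset.mem_image.2 ⟨i, ?_, hpi⟩)
          rw [Finset.mem_erase, Finset.mem_range]
          refine ⟨?_, hi⟩
          rintro rfl
          have := hp i hi hA
          omega
      have h1 := Finset.card_le_card this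
      have h2 := Finset.card_insert_le (d.n + 1) (((Finset.range d.n).erase j).image p)
      have h3 := Finset.card_image_le (s := (Finset.range d.n).erase j) (f := p)
      rw [Finset.card_erase_of_mem (Finset.mem_range.2 hj), Finset.card_range] at h3
      rw [Nat.card_Icc] at h1
      omega
    · push Not at hN
      -- Nobody approves `c`, so any level above all prices will do.
      obtain ⟨i, hi, hpi⟩ := hcon ((Finset.range d.n).sup p + 1) (by omega)
        fun j hj hA => absurd hA (hN j hj)
      have := Finset.le_sup (f := p) (Finset.mem_range.2 hi)
      omega
  set B := (Finset.range d.n).filter fun i => L < p i with hB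
  set S := insert c (B.image o) with hS
  have hBsold : ∀ i ∈ B, i < d.n ∧ p i ≠ 0 := by
    intro i hi
    simp only [hB, Finset.mem_filter, Finset.mem_range] at hi
    exact ⟨hi.1, by omega⟩
  have hSJ : ∀ x ∈ S, d.J x := by
    intro x hx
    rcases Finset.mem_insert.1 hx with rfl | hx
    · exact hc
    · obtain ⟨i, hi, rfl⟩ := Finset.mem_image.1 hx
      exact (h.owner i (hBsold i hi).1 (hBsold i hi).2).2
  -- `S` draws on no voters outside `B`: a voter approving an owner of a voter in `B` costs at least
  -- `L` by the price condition, and no voter costs exactly `L`.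
  have hSB : ∀ x ∈ S, ∀ j < d.n, d.A j x → j ∈ B := by
    intro x hx j hj hA
    simp only [hB, Finset.mem_filter, Finset.mem_range]
    refine ⟨hj, ?_⟩
    rcases Finset.mem_insert.1 hx with rfl | hx
    · exact hL2 j hj hA
    · obtain ⟨i, hi, rfl⟩ := Finset.mem_image.1 hx
      have h1 := h.price i (hBsold i hi).1 (hBsold i hi).2 j hj hA
      simp only [hB, Finset.mem_filter, Finset.mem_range] at hi
      have := hgap j hj
      omega
  have h1 : ∑ x ∈ S, (D.filter fun i => g i = x).card ≤ B.card := by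
    rw [← Finset.card_biUnion]
    · refine Finset.card_le_card ?_
      intro i hi
      obtain ⟨x, hx, hi⟩ := Finset.mem_biUnion.1 hi
      rw [Finset.mem_filter] at hi
      exact hSB x hx i (Finset.mem_range.1 (hD hi.1)) (hi.2 ▸ (hg i hi.1).1)
    · intro x _ y _ hxy
      simp only [Finset.disjoint_left, Finset.mem_filter]
      rintro i ⟨_, rfl⟩ ⟨_, h⟩
      exact hxy h
  have h2 : B.card ≤ ∑ x ∈ S, ((d.sold p).filter fun i => o i = x).card := by
    rw [← Finset.card_biUnion]
    · refine Finset.card_le_card ?_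
      intro i hi
      refine Finset.mem_biUnion.2 ⟨o i, Finset.mem_insert_of_mem (Finset.mem_image_of_mem _ hi), ?_⟩
      rw [Finset.mem_filter, Data.mem_sold]
      exact ⟨hBsold i hi, rfl⟩
    · intro x _ y _ hxy
      simp only [Finset.disjoint_left, Finset.mem_filter]
      rintro i ⟨_, rfl⟩ ⟨_, h⟩
      exact hxy h
  -- By tightness, a member of `S` that owns voters holds no more than any solution must give it,
  -- while `c` is still strictly short. So `S` needs more voters than `B` contains.
  have h3 : ∑ x ∈ S, ((d.sold p).filter fun i => o i = x).card <
      ∑ x ∈ S, (D.filter fun i => g i = x).card := by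
    refine Finset.sum_lt_sum (fun x hx => ?_) ⟨c, Finset.mem_insert_self _ _, ?_⟩
    · have e1 := h.score x (hSJ x hx)
      have e2 := hsol x (hSJ x hx)
      by_cases h0 : ((d.sold p).filter fun i => o i = x).card = 0
      · omega
      · obtain ⟨i, hi⟩ := Finset.card_pos.1 (Nat.pos_of_ne_zero h0)
        rw [Finset.mem_filter, Data.mem_sold] at hi
        have := h.tight i hi.1.1 hi.1.2
        rw [hi.2] at this
        omega
    · have e1 := h.score c hc
      have e2 := hsol c hc
      omega
  omega

/-- When all items are satisfied, the sold voters form a solution, and the smallest one. -/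
theorem Data.Inv.isSolution (h : d.Inv p o r) (hr : ∀ c, d.J c → r c < d.τ) :
    d.IsSolution (d.sold p) o := by
  refine ⟨Finset.filter_subset _ _, fun i hi => ?_, fun c hc => ?_⟩
  · rw [Data.mem_sold] at hi
    exact h.owner i hi.1 hi.2
  · have := h.score c hc
    have := hr c hc
    omega

/-- By tightness each owner holds at most the number of voters that every solution has to assign to
it. This is true at every stage of the auction. -/
theorem Data.Inv.card_sold_le (h : d.Inv p o r) {D : Finset ℕ} {g : ℕ → ℕ}
    (hD : d.IsSolution D g) : (d.sold p).card ≤ D.card := by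
  classical
  rw [Finset.card_eq_sum_card_image o (d.sold p)]
  calc _ ≤ ∑ x ∈ (d.sold p).image o, (D.filter fun i => g i = x).card := by
        refine Finset.sum_le_sum fun x hx => ?_
        obtain ⟨i, hi, rfl⟩ := Finset.mem_image.1 hx
        rw [Data.mem_sold] at hi
        have hJ := (h.owner i hi.1 hi.2).2
        have := h.score _ hJ
        have := hD.2.2 _ hJ
        have := h.tight i hi.1 hi.2
        omega
    _ ≤ D.card := by
        rw [← Finset.card_biUnion]
        · exact Finset.card_le_card fun i hi => by
            obtain ⟨x, _, hi⟩ := Finset.mem_biUnion.1 hi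
            exact (Finset.mem_filter.1 hi).1
        · intro x _ y _ hxy
          simp only [Finset.disjoint_left, Finset.mem_filter]
          rintro i ⟨_, rfl⟩ ⟨_, h⟩
          exact hxy h

end Auction

/-! ### Destructive bribery under AV as an assignment problem -/

namespace ApprovalVoting

section Winning

variable {C ι : Type} [DecidableEq C] [Fintype ι]

/-- The number of approvals of a candidate. -/
def approvals (V : ι → Finset C) (c : C) : ℕ := (Finset.univ.filter fun i => c ∈ V i).card

theorem avScore_eq_sum (V : ι → Finset C) (w : Finset C) :
    avScore V w = ∑ c ∈ w, approvals V c := by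
  simp only [avScore, approvals, Finset.card_filter]
  rw [Finset.sum_comm]
  refine Finset.sum_congr rfl fun i _ => ?_
  rw [Finset.inter_comm, ← Finset.filter_mem_eq_inter, Finset.card_filter]

theorem avScore_swap (V : ι → Finset C) {w : Finset C} {a b : C} (ha : a ∉ w) (hb : b ∈ w) :
    (insert a (w.erase b)).card = w.card ∧
      avScore V (insert a (w.erase b)) + approvals V b = avScore V w + approvals V a := by
  have ha' : a ∉ w.erase b := fun h => ha (Finset.mem_of_mem_erase h)
  constructor
  · rw [Finset.card_insert_of_notMem ha', Finset.card_erase_add_one hb]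
  · rw [avScore_eq_sum, avScore_eq_sum, Finset.sum_insert ha', ← Finset.sum_erase_add w _ hb]
    ring

/-- A candidate is in no winning `k`-committee iff `k` candidates have more approvals. -/
theorem forall_winning_notMem_iff [Fintype C] (V : ι → Finset C) {k : ℕ} (hk : k ≤ Fintype.card C)
    (c : C) : (∀ w, IsWinningAV V k w → c ∉ w) ↔
      k ≤ (Finset.univ.filter fun c' => approvals V c < approvals V c').card := by
  constructor
  · intro h
    by_contra! hlt
    obtain ⟨w, hw, hmax⟩ := Finset.exists_max_image (Finset.univ.powersetCard k : Finset (Finset C))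
      (avScore V) (Finset.powersetCard_nonempty.2 (by simpa using hk))
    have hwk : w.card = k := (Finset.mem_powersetCard.1 hw).2
    have hwin : IsWinningAV V k w :=
      ⟨hwk, fun w' hw' => hmax w' (Finset.mem_powersetCard.2 ⟨Finset.subset_univ _, hw'⟩)⟩
    have hc := h w hwin
    -- Fewer than `k` candidates beat `c`, so some member `b` of the winning committee does not.
    -- Exchanging `b` for `c` does not lower the score and gives a winning committee that contains
    -- `c`.
    obtain ⟨b, hb, hbn⟩ := Finset.exists_mem_notMem_of_card_lt_card (hlt.trans_eq hwk.symm)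
    simp only [Finset.mem_filter, Finset.mem_univ, true_and, not_lt] at hbn
    obtain ⟨h1, h2⟩ := avScore_swap V hc hb
    refine h _ ⟨h1.trans hwk, fun w' hw' => ?_⟩ (Finset.mem_insert_self c _)
    have := hwin.2 w' hw'
    omega
  · rintro h w ⟨hwk, hw⟩ hc
    obtain ⟨a, ha, haw⟩ : ∃ a, approvals V c < approvals V a ∧ a ∉ w := by
      by_contra! hcon
      have : (Finset.univ.filter fun c' => approvals V c < approvals V c') ⊆ w.erase c := by
        intro a ha
        simp only [Finset.mem_filter, Finset.mem_univ, true_and] at ha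
        refine Finset.mem_erase.2 ⟨?_, hcon a ha⟩
        rintro rfl
        exact lt_irrefl _ ha
      have := Finset.card_le_card this
      rw [Finset.card_erase_of_mem hc] at this
      have := Finset.card_pos.2 ⟨c, hc⟩
      omega
    obtain ⟨h1, h2⟩ := avScore_swap V haw hc
    have := hw _ (h1.trans hwk)
    omega

end Winning

/-- This is what `r = 1` gives: a bribed voter can lower the score of a single candidate, which
makes the problem one of assignment. -/
theorem isVDC_one_iff {C : Type} [DecidableEq C] (v v' : Finset C) :
    IsVDC 1 v v' ↔ ∃ c ∈ v, v' = v.erase c := by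
  constructor
  · rintro ⟨h1, h2⟩
    obtain ⟨c, hc, hc'⟩ := Finset.exists_of_ssubset h1
    refine ⟨c, hc, ?_⟩
    have h3 : (v \ v').card ≤ 1 := by unfold voteDist at h2; omega
    rw [Finset.card_le_one] at h3
    ext a
    rw [Finset.mem_erase]
    refine ⟨fun ha => ⟨fun h => hc' (h ▸ ha), h1.1 ha⟩, fun ⟨h4, h5⟩ => ?_⟩
    by_contra ha
    exact h4 (h3 a (by simp [h5, ha]) c (by simp [hc, hc']))
  · rintro ⟨c, hc, rfl⟩
    refine ⟨Finset.erase_ssubset hc, ?_⟩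
    have h1 : v.erase c \ v = ∅ := Finset.sdiff_eq_empty_iff_subset.2 (Finset.erase_subset _ _)
    have h2 : v \ v.erase c ⊆ {c} := by
      intro a; simp only [Finset.mem_sdiff, Finset.mem_erase, Finset.mem_singleton]; tauto
    have := Finset.card_le_card h2
    rw [Finset.card_singleton] at this
    simpa [voteDist, h1] using this

theorem count_eq_card_fin (p : ℕ → Prop) [DecidablePred p] (n : ℕ) :
    Nat.count p n = (Finset.univ.filter fun i : Fin n => p i).card := by
  rw [Nat.count_eq_card_filter_range, ← Finset.card_map Fin.valEmbedding]
  congr 1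
  ext i
  simp only [Finset.mem_filter, Finset.mem_range, Finset.mem_map, Finset.mem_univ, true_and,
    Fin.valEmbedding_apply]
  exact ⟨fun h => ⟨⟨i, h.1⟩, h.2, rfl⟩, by rintro ⟨j, hj, rfl⟩; exact ⟨j.2, hj⟩⟩

/-- The number of elements of a bounded initial segment determines its members. -/
theorem lt_count_iff {p : ℕ → Prop} [DecidablePred p] {n : ℕ}
    (hp : ∀ a b, a ≤ b → p b → p a) (hn : ∀ a, p a → a < n) (t : ℕ) :
    t < Nat.count p n ↔ p t := by
  rw [Nat.count_eq_card_filter_range]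
  constructor
  · intro h
    by_contra ht
    have : (Finset.range n).filter p ⊆ Finset.range t := by
      intro a ha
      rw [Finset.mem_filter] at ha
      rw [Finset.mem_range]
      by_contra! hta
      exact ht (hp _ _ hta ha.2)
    have := Finset.card_le_card this
    rw [Finset.card_range] at this
    exact absurd (h.trans_le this) (lt_irrefl _)
  · intro h
    have : Finset.range (t + 1) ⊆ (Finset.range n).filter p := by
      intro a ha
      rw [Finset.mem_range] at ha
      have := hp a t (by omega) h
      exact Finset.mem_filter.2 ⟨Finset.mem_range.2 (hn a this), this⟩
    have := Finset.card_le_card this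
    rwa [Finset.card_range] at this

/-! ### The threshold and the assignment problem of an instance. -/

namespace BriberyInstance

variable (I : BriberyInstance)

/-- Whether voter `i` approves candidate `c`. -/
def voteBit (i c : ℕ) : Bool :=
  if h : i < I.n ∧ c < I.m then decide ((⟨c, h.2⟩ : Fin I.m) ∈ I.vote ⟨i, h.1⟩) else false

/-- Whether candidate `c` is distinguished. -/
def jBit (c : ℕ) : Bool :=
  if h : c < I.m then decide ((⟨c, h⟩ : Fin I.m) ∈ I.J) else false

/-- The number of approvals of candidate `c`. -/
def score (c : ℕ) : ℕ := Nat.count (fun i => I.voteBit i c = true) I.n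

/-- The number of candidates outside `J` with more than `t` approvals. -/
def rivals (t : ℕ) : ℕ := Nat.count (fun c => I.jBit c = false ∧ t < I.score c) I.m

/-- The `k`-th largest number of approvals outside `J`. -/
def threshold : ℕ := Nat.count (fun t => I.k ≤ I.rivals t) I.n

/-- The assignment problem of a bribery instance. -/
def data : Auction.Data where
  n := I.n
  A i c := I.voteBit i c = true
  J c := I.jBit c = true
  score := I.score
  τ := I.threshold

@[simp] theorem voteBit_fin (i : Fin I.n) (c : Fin I.m) : I.voteBit i c = true ↔ c ∈ I.vote i := by
  simp [voteBit]

@[simp] theorem jBit_fin (c : Fin I.m) : I.jBit c = true ↔ c ∈ I.J := by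
  simp [jBit]

theorem lt_of_jBit {c : ℕ} (h : I.jBit c = true) : c < I.m := by
  by_contra hc
  simp [jBit, hc] at h

theorem score_fin (c : Fin I.m) : I.score c = approvals I.vote c := by
  rw [score, count_eq_card_fin, approvals]
  simp

theorem score_le (c : ℕ) : I.score c ≤ I.n := Nat.count_le _

theorem rivals_eq (t : ℕ) : I.rivals t =
    (Finset.univ.filter fun c : Fin I.m => c ∉ I.J ∧ t < approvals I.vote c).card := by
  rw [rivals, count_eq_card_fin]
  congr 1
  ext c
  simp [score_fin, ← jBit_fin]

/-- `rivals` is antitone, and it vanishes from `n` on because no score exceeds `n`. As `k` is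
positive, the levels with at least `k` rivals form an initial segment below `n`, whose size is the
threshold. -/
theorem lt_threshold_iff (t : ℕ) : t < I.threshold ↔ I.k ≤ I.rivals t := by
  refine lt_count_iff (fun a b hab h => h.trans ?_) (fun a h => ?_) t
  swap
  · rw [rivals_eq, rivals_eq]
    refine Finset.card_le_card fun c hc => ?_
    simp only [Finset.mem_filter, Finset.mem_univ, true_and] at hc ⊢
    exact ⟨hc.1, hab.trans_lt hc.2⟩
  · by_contra! hn
    have : I.rivals a = 0 := by
      rw [rivals, Nat.count_eq_card_filter_range, Finset.card_eq_zero, Finset.filter_eq_empty_iff]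
      rintro c _ ⟨_, hc⟩
      exact absurd ((I.score_le c).trans hn) (not_le.2 hc)
    have := I.k_pos
    omega

/-- The condition on the numbers of approvals after the bribery. -/
theorem forall_winning_iff (W : Fin I.n → Finset (Fin I.m)) :
    (∀ w, IsWinningAV W I.k w → ∀ c ∈ I.J, c ∉ w) ↔
      ∀ c ∈ I.J, I.k ≤ (Finset.univ.filter
        fun c' => c' ∉ I.J ∧ approvals W c < approvals W c').card := by
  have h1 : ∀ c, _ := fun c => forall_winning_notMem_iff W (k := I.k) (by simpa using I.k_le) c
  have h2 : (∀ w, IsWinningAV W I.k w → ∀ c ∈ I.J, c ∉ w) ↔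
      ∀ c ∈ I.J, ∀ w, IsWinningAV W I.k w → c ∉ w := by tauto
  rw [h2]
  simp only [h1]
  constructor
  · intro h c hc
    -- A best candidate `a` of `J` can only be beaten from outside `J`, and whoever beats `a` beats
    -- `c`.
    obtain ⟨a, ha, hmax⟩ := Finset.exists_max_image I.J (approvals W) I.J_nonempty
    refine (h a ha).trans (Finset.card_le_card fun x hx => ?_)
    simp only [Finset.mem_filter, Finset.mem_univ, true_and] at hx ⊢
    refine ⟨fun hxJ => ?_, (hmax c hc).trans_lt hx⟩
    have := hmax x hxJ
    omega
  · intro h c hc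
    refine (h c hc).trans (Finset.card_le_card fun x hx => ?_)
    simp only [Finset.mem_filter, Finset.mem_univ, true_and] at hx ⊢
    exact hx.2

/-- The threshold on the right belongs to the original election. A bribery only lowers approvals, so
it cannot raise the threshold; conversely, removing only candidates of `J` leaves all rivals
untouched. -/
theorem isYes_iff_fin : IsYesVDC 1 I ↔ ∃ (D : Finset (Fin I.n)) (g : Fin I.n → Fin I.m),
    (∀ i ∈ D, g i ∈ I.vote i ∧ g i ∈ I.J) ∧ D.card ≤ I.l ∧
    ∀ c ∈ I.J, approvals I.vote c < I.threshold + (D.filter fun i => g i = c).card := by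
  constructor
  · obtain ⟨c₀, -⟩ := I.J_nonempty
    rintro ⟨V', W, hcard, hV, hW, hwin⟩
    rw [forall_winning_iff] at hwin
    have hg : ∀ i, ∃ c, i ∈ V' → c ∈ I.vote i ∧ W i = (I.vote i).erase c := by
      intro i
      by_cases hi : i ∈ V'
      · obtain ⟨c, h⟩ := (isVDC_one_iff _ _).1 (hV i hi)
        exact ⟨c, fun _ => h⟩
      · exact ⟨c₀, fun h => absurd h hi⟩
    choose g hg using hg
    -- Voters that lose a candidate outside `J` are dropped, since they lower no score in `J`.
    refine ⟨V'.filter fun i => g i ∈ I.J, g, fun i hi => ?_, ?_, fun c hc => ?_⟩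
    · rw [Finset.mem_filter] at hi
      exact ⟨(hg i hi.1).1, hi.2⟩
    · exact (Finset.card_le_card (Finset.filter_subset _ _)).trans hcard
    · have hsub : ∀ i, W i ⊆ I.vote i := by
        intro i
        by_cases hi : i ∈ V'
        · rw [(hg i hi).2]; exact Finset.erase_subset _ _
        · rw [hW i hi]
      have h1 : approvals I.vote c ≤ approvals W c +
          ((V'.filter fun i => g i ∈ I.J).filter fun i => g i = c).card := by
        unfold approvals
        refine (Finset.card_le_card ?_).trans (Finset.card_union_le _ _)
        intro i hi
        simp only [Finset.mem_filter, Finset.mem_univ, true_and, Finset.mem_union] at hi ⊢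
        by_cases hiV : i ∈ V'
        · by_cases hgc : g i = c
          · right; exact ⟨⟨hiV, hgc ▸ hc⟩, hgc⟩
          · left; rw [(hg i hiV).2]; exact Finset.mem_erase.2 ⟨Ne.symm hgc, hi⟩
        · left; rwa [hW i hiV]
      have h2 : approvals W c < I.threshold := by
        rw [lt_threshold_iff, rivals_eq]
        refine (hwin c hc).trans (Finset.card_le_card fun x hx => ?_)
        simp only [Finset.mem_filter, Finset.mem_univ, true_and] at hx ⊢
        refine ⟨hx.1, hx.2.trans_le (Finset.card_le_card fun i hi => ?_)⟩
        simp only [Finset.mem_filter, Finset.mem_univ, true_and] at hi ⊢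
        exact hsub i hi
      omega
  · rintro ⟨D, g, hg, hcard, hlt⟩
    refine ⟨D, fun i => if i ∈ D then (I.vote i).erase (g i) else I.vote i, hcard, ?_, ?_, ?_⟩
    · intro i hi
      rw [isVDC_one_iff]
      exact ⟨g i, (hg i hi).1, by simp [hi]⟩
    · intro i hi
      simp [hi]
    · rw [forall_winning_iff]
      set W : Fin I.n → Finset (Fin I.m) :=
        fun i => if i ∈ D then (I.vote i).erase (g i) else I.vote i with hW
      have h0 : ∀ c i, c ∈ W i ↔ c ∈ I.vote i ∧ ¬ (i ∈ D ∧ g i = c) := by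
        intro c i
        simp only [hW]
        split_ifs with h
        · simp [h, eq_comm, and_comm]
        · simp [h]
      intro c hc
      have h1 : approvals W c + (D.filter fun i => g i = c).card ≤ approvals I.vote c := by
        unfold approvals
        rw [← Finset.card_union_of_disjoint]
        · refine Finset.card_le_card fun i hi => ?_
          simp only [Finset.mem_filter, Finset.mem_univ, true_and, Finset.mem_union, h0] at hi ⊢
          rcases hi with hi | ⟨hi, rfl⟩
          · exact hi.1
          · exact (hg i hi).1
        · rw [Finset.disjoint_left]
          intro i hi hi'
          simp only [Finset.mem_filter, Finset.mem_univ, true_and, h0] at hi hi'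
          exact hi.2 hi'
      have h2 : approvals W c < I.threshold := by have := hlt c hc; omega
      rw [lt_threshold_iff, rivals_eq] at h2
      refine h2.trans (Finset.card_le_card fun x hx => ?_)
      simp only [Finset.mem_filter, Finset.mem_univ, true_and] at hx ⊢
      refine ⟨hx.1, hx.2.trans_le (Finset.card_le_card fun i hi => ?_)⟩
      simp only [Finset.mem_filter, Finset.mem_univ, true_and, h0] at hi ⊢
      exact ⟨hi, fun h => hx.1 (h.2 ▸ (hg i h.1).2)⟩

theorem isYes_iff : IsYesVDC 1 I ↔
    ∃ (D : Finset ℕ) (g : ℕ → ℕ), I.data.IsSolution D g ∧ D.card ≤ I.l := by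
  rw [isYes_iff_fin]
  constructor
  · rintro ⟨D, g, hg, hcard, hlt⟩
    refine ⟨D.map Fin.valEmbedding, fun i => if h : i < I.n then g ⟨i, h⟩ else 0,
      ⟨?_, ?_, ?_⟩, by simpa using hcard⟩
    · intro i hi
      obtain ⟨j, _, rfl⟩ := Finset.mem_map.1 hi
      exact Finset.mem_range.2 j.2
    · intro i hi
      obtain ⟨j, hj, rfl⟩ := Finset.mem_map.1 hi
      simp only [data, Fin.valEmbedding_apply, Fin.is_lt, dite_true, voteBit_fin, jBit_fin]
      exact hg j hj
    · intro c hc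
      have hcm := I.lt_of_jBit hc
      have h1 := hlt ⟨c, hcm⟩ ((I.jBit_fin ⟨c, hcm⟩).1 hc)
      rw [← score_fin] at h1
      refine h1.trans_eq ?_
      change _ = I.threshold + _
      congr 1
      rw [Finset.filter_map, Finset.card_map]
      congr 1
      ext i
      simp [Fin.ext_iff]
  · obtain ⟨c₀, -⟩ := I.J_nonempty
    rintro ⟨D, g, ⟨hD, hg, hlt⟩, hcard⟩
    have hgm : ∀ i ∈ D, g i < I.m := fun i hi => I.lt_of_jBit (hg i hi).2
    refine ⟨Finset.univ.filter fun i => (i : ℕ) ∈ D,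
      fun i => if h : g i < I.m then ⟨g i, h⟩ else c₀, ?_, ?_, ?_⟩
    · intro i hi
      simp only [Finset.mem_filter, Finset.mem_univ, true_and] at hi
      beta_reduce
      rw [dif_pos (hgm _ hi), ← voteBit_fin, ← jBit_fin]
      exact hg i hi
    · refine le_trans ?_ hcard
      rw [← Finset.card_map Fin.valEmbedding]
      refine Finset.card_le_card fun i hi => ?_
      obtain ⟨j, hj, rfl⟩ := Finset.mem_map.1 hi
      simpa using hj
    · intro c hc
      have h1 := hlt c ((I.jBit_fin c).2 hc)
      change I.score c < I.threshold + _ at h1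
      rw [score_fin] at h1
      refine h1.trans_eq ?_
      congr 1
      rw [← Finset.card_map Fin.valEmbedding]
      congr 1
      ext i
      simp only [Finset.mem_filter, Finset.mem_map, Finset.mem_univ, true_and,
        Fin.valEmbedding_apply]
      constructor
      · rintro ⟨hi, hgi⟩
        refine ⟨⟨i, Finset.mem_range.1 (hD hi)⟩, ⟨hi, ?_⟩, rfl⟩
        simp [hgi]
      · rintro ⟨j, ⟨hj, hgj⟩, rfl⟩
        rw [dif_pos (hgm _ hj)] at hgj
        exact ⟨hj, by rw [← hgj]⟩

end BriberyInstance

end ApprovalVoting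

/-! ### The input word in memory -/

namespace ApprovalVoting

theorem getD_flatten {α : Type} (L : List (List α)) {m : ℕ} (hL : ∀ u ∈ L, u.length = m)
    (i : ℕ) {c : ℕ} (hc : c < m) (d : α) :
    L.flatten.getD (i * m + c) d = (L.getD i []).getD c d := by
  induction L generalizing i with
  | nil => simp
  | cons u L ih =>
    have hu : u.length = m := hL u (by simp)
    rw [List.flatten_cons]
    cases i with
    | zero => rw [List.getD_append _ _ _ _ (by omega)]; simp
    | succ i =>
      rw [List.getD_append_right _ _ _ _ (by rw [Nat.add_mul]; omega), List.getD_cons_succ,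
        ← ih (fun v hv => hL v (by simp [hv])), hu]
      congr 1
      rw [Nat.add_mul]
      omega

theorem getD_setCode {m : ℕ} (S : Finset (Fin m)) (c : Fin m) :
    (setCode S).getD c false = decide (c ∈ S) := by
  simp [setCode, List.getD_eq_getElem?_getD]

@[simp] theorem length_unaryCode (a : ℕ) : (unaryCode a).length = a + 1 := by simp [unaryCode]

@[simp] theorem length_setCode {m : ℕ} (S : Finset (Fin m)) : (setCode S).length = m := by
  simp [setCode]

theorem getD_unaryCode_append (a j : ℕ) (u : List Bool) (hj : j ≤ a) :
    (unaryCode a ++ u).getD j false = decide (j < a) := by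
  rw [List.getD_append _ _ _ _ (by simp; omega), unaryCode]
  rcases hj.lt_or_eq with h | rfl
  · rw [List.getD_append _ _ _ _ (by simpa using h)]
    simp [h, List.getD_eq_getElem?_getD]
  · rw [List.getD_append_right _ _ _ _ (by simp)]
    simp

/-- The unary code of `a` stands in memory from address `p` on. -/
def UnaryAt (w : ℕ → ℕ) (p a : ℕ) : Prop := (∀ j < a, w (p + j) ≠ 0) ∧ w (p + a) = 0

theorem unaryAt_of_append (u : List Bool) (a : ℕ) (v : List Bool) (x : List Bool)
    (h : x = u ++ (unaryCode a ++ v)) :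
    UnaryAt (fun i => (x.getD i false).toNat) u.length a := by
  subst h
  constructor
  · intro j hj
    beta_reduce
    rw [List.getD_append_right _ _ _ _ (by omega), Nat.add_sub_cancel_left,
      getD_unaryCode_append _ _ _ hj.le]
    simp [hj]
  · beta_reduce
    rw [List.getD_append_right _ _ _ _ (by omega), Nat.add_sub_cancel_left,
      getD_unaryCode_append _ _ _ le_rfl]
    simp

namespace BriberyInstance

variable (I : BriberyInstance)

/-- The memory at the start. -/
def input (i : ℕ) : ℕ := (I.encode.getD i false).toNat

/-- The address of the set of distinguished candidates. -/
def jBase : ℕ := I.m + I.n + I.k + I.l + 4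

/-- The address of the first vote. -/
def voteBase : ℕ := I.jBase + I.m

theorem length_encode : I.encode.length = I.voteBase + I.n * I.m := by
  have : (List.ofFn fun i => setCode (I.vote i)).flatten.length = I.n * I.m := by
    rw [List.length_flatten, List.map_ofFn]
    simp [Function.comp_def, List.ofFn_const]
  simp only [encode, List.length_append, length_unaryCode, length_setCode, this, voteBase, jBase]
  omega

theorem unaryAt_m : UnaryAt I.input 0 I.m :=
  unaryAt_of_append [] I.m _ I.encode (by simp only [encode, List.append_assoc]; rfl)

theorem unaryAt_n : UnaryAt I.input (I.m + 1) I.n := by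
  have := unaryAt_of_append (unaryCode I.m) I.n _ I.encode
    (by simp only [encode, List.append_assoc]; rfl)
  rwa [length_unaryCode] at this

theorem unaryAt_k : UnaryAt I.input (I.m + I.n + 2) I.k := by
  have := unaryAt_of_append (unaryCode I.m ++ unaryCode I.n) I.k _ I.encode
    (by simp only [encode, List.append_assoc]; rfl)
  rw [List.length_append, length_unaryCode, length_unaryCode] at this
  rwa [show I.m + I.n + 2 = I.m + 1 + (I.n + 1) by omega]

theorem unaryAt_l : UnaryAt I.input (I.m + I.n + I.k + 3) I.l := by
  have := unaryAt_of_append (unaryCode I.m ++ unaryCode I.n ++ unaryCode I.k) I.l _ I.encode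
    (by simp only [encode, List.append_assoc]; rfl)
  rw [List.length_append, List.length_append, length_unaryCode, length_unaryCode,
    length_unaryCode] at this
  rwa [show I.m + I.n + I.k + 3 = I.m + 1 + (I.n + 1) + (I.k + 1) by omega]

theorem input_jBase {c : ℕ} (hc : c < I.m) : I.input (I.jBase + c) = (I.jBit c).toNat := by
  have hl : (unaryCode I.m ++ unaryCode I.n ++ unaryCode I.k ++ unaryCode I.l).length =
      I.jBase := by
    simp only [List.length_append, length_unaryCode, jBase]; omega
  unfold input encode
  rw [List.append_assoc, List.getD_append_right _ _ _ _ (by omega), hl, Nat.add_sub_cancel_left,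
    List.getD_append _ _ _ _ (by simpa using hc), jBit, dif_pos hc, ← getD_setCode]

theorem input_voteBase {i c : ℕ} (hi : i < I.n) (hc : c < I.m) :
    I.input (I.voteBase + (i * I.m + c)) = (I.voteBit i c).toNat := by
  have hl : (unaryCode I.m ++ unaryCode I.n ++ unaryCode I.k ++ unaryCode I.l ++
      setCode I.J).length = I.voteBase := by
    simp only [List.length_append, length_unaryCode, length_setCode, voteBase, jBase]; omega
  unfold input encode
  rw [List.getD_append_right _ _ _ _ (by omega), hl, Nat.add_sub_cancel_left,
    getD_flatten _ (m := I.m) (by simp [List.mem_ofFn]) _ hc, voteBit, dif_pos ⟨hi, hc⟩,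
    ← getD_setCode]
  simp [List.getD_eq_getElem?_getD, hi]

/-- Memory beyond the word is zero, so the tables of prices, owners and scores placed there need no
initialisation. -/
theorem input_of_le {a : ℕ} (h : I.encode.length ≤ a) : I.input a = 0 := by
  rw [input, List.getD_eq_default _ _ h]; rfl

end BriberyInstance

end ApprovalVoting

/-! ### Loop-free programs by evaluation. -/

namespace RAM

/-- Whether a program contains no loop. -/
def Prog.loopFree : Prog → Bool
  | .skip => true
  | .op _ => true
  | .seq p q => p.loopFree && q.loopFree
  | .ite _ p q => p.loopFree && q.loopFree
  | .loop _ _ => false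

/-- The number of steps that suffices for a loop-free program. -/
def Prog.cost : Prog → ℕ
  | .skip => 1
  | .op _ => 1
  | .seq p q => p.cost + q.cost + 1
  | .ite _ p q => max p.cost q.cost + 1
  | .loop _ _ => 0

/-- The effect of a loop-free program. -/
def Prog.exec : Prog → Store → Store
  | .skip, s => s
  | .op o, s => o.apply s
  | .seq p q, s => q.exec (p.exec s)
  | .ite x p q, s => if s.reg x = 0 then q.exec s else p.exec s
  | .loop _ _, s => s

/-- Loop-free code is handled by computing its final store with `simp`. The values of `cost` and
`exec` at a loop are dummies, excluded by `hP`. -/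
theorem Within.exec {P : Prog} (hP : P.loopFree = true) {s : Store} {Q : Store → Prop} {t : ℕ}
    (ht : P.cost ≤ t) (h : Q (P.exec s)) : Within P t s Q := by
  refine Within.mono (t := P.cost) (Q := fun s' => s' = P.exec s) ?_ ht (by rintro _ rfl; exact h)
  clear h ht
  induction P generalizing s with
  | skip => exact Within.skip le_rfl rfl
  | op o => exact ⟨1, le_rfl, o.apply s, rfl, fun _ => rfl⟩
  | seq p q ihp ihq =>
    simp only [Prog.loopFree, Bool.and_eq_true] at hP
    exact ((ihp hP.1).mono le_rfl (by rintro _ rfl; exact ihq hP.2)).seq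
  | ite x p q ihp ihq =>
    simp only [Prog.loopFree, Bool.and_eq_true] at hP
    refine Within.ite (fun hx => ?_) fun hx => ?_
    · simpa [Prog.exec, hx] using (ihp hP.1).mono (le_max_left _ _) fun _ h => h
    · simpa [Prog.exec, hx] using (ihq hP.2).mono (le_max_right _ _) fun _ h => h
  | loop x p => simp [Prog.loopFree] at hP

/-- All loops get a bound in terms of the input length `N`; the additional round in `N + 1` pays for
the final test. -/
theorem Within.forLoop {x : ℕ} {P : Prog} {T n N : ℕ} (hn : n ≤ N) (Inv : ℕ → Store → Prop)
    (hx : ∀ j s, Inv j s → s.reg x = n - j)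
    (hP : ∀ j s, j < n → Inv j s → Within P T s (Inv (j + 1)))
    {s : Store} (hs : Inv 0 s) :
    Within (.loop x P) ((N + 1) * (T + 1)) s (Inv n) := by
  refine (Within.for Inv hx hP hs).mono ?_ fun _ h => h
  have := Nat.mul_le_mul_right (T + 1) hn
  rw [Nat.add_mul]
  omega

end RAM

namespace ApprovalVoting

open RAM

/-! ### Parsing -/

/-- Read the unary number at the address in register 6 into register `x`. -/
def readUnary (x : ℕ) : Prog :=
  .seq (block [.load 12 6])
    (.seq (.loop 12 (block [.add x x 1, .add 6 6 1, .load 12 6])) (block [.add 6 6 1]))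

/-- The number of rounds is not known beforehand, so register 12 always holds the bit at the current
address and controls the loop. Registers 1 and 6 are the constant one and the reading position. -/
theorem within_readUnary {x : ℕ} (hx1 : x ≠ 1) (hx6 : x ≠ 6) (hx12 : x ≠ 12) {s : Store}
    {p a N : ℕ} (h : UnaryAt s.mem p a) (haN : a ≤ N) (h1 : s.reg 1 = 1) (h6 : s.reg 6 = p)
    (hx : s.reg x = 0) :
    Within (readUnary x) (8 * N + 20) s fun s' => s'.mem = s.mem ∧ s'.reg 6 = p + a + 1 ∧
      s'.reg x = a ∧ ∀ y, y ≠ x → y ≠ 6 → y ≠ 12 → s'.reg y = s.reg y := by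
  have hloop : ∀ s₁ : Store, s₁ = (block [.load 12 6]).exec s →
      Within (.loop 12 (block [.add x x 1, .add 6 6 1, .load 12 6])) (a * (7 + 1) + 1) s₁
        fun s' => s'.reg 12 = 0 ∧ ∃ v, ∃ j ≤ a, v = a - j ∧ s'.mem = s.mem ∧
          s'.reg 6 = p + j ∧ s'.reg x = j ∧ s'.reg 12 = s.mem (p + j) ∧
          ∀ y, y ≠ x → y ≠ 6 → y ≠ 12 → s'.reg y = s.reg y := by
    rintro s₁ rfl
    refine Within.loop (fun v s' => ∃ j ≤ a, v = a - j ∧ s'.mem = s.mem ∧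
          s'.reg 6 = p + j ∧ s'.reg x = j ∧ s'.reg 12 = s.mem (p + j) ∧
          ∀ y, y ≠ x → y ≠ 6 → y ≠ 12 → s'.reg y = s.reg y) ?_ ⟨0, by omega, by simp, ?_⟩
    · rintro v s' ⟨j, hj, rfl, hm, e6, ex, e12, hfr⟩ h0
      have hja : j ≠ a := by
        rintro rfl
        exact h0 (e12.trans h.2)
      refine Within.exec rfl (by simp [Prog.cost, block])
        ⟨a - (j + 1), by omega, j + 1, by omega, rfl, ?_⟩
      have e1 : s'.reg 1 = 1 := by rw [hfr 1 hx1.symm (by decide) (by decide), h1]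
      simp only [Prog.exec, block, Op.apply, Function.update_apply]
      refine ⟨hm, ?_, ?_, ?_, ?_⟩
      · simp [hx1.symm, e1, e6, hx6.symm]; omega
      · simp [hx6, hx12, ex, e1]
      · simp [hm, hx1.symm, hx6.symm, e6, e1]; congr 1
      · intro y hy1 hy2 hy3
        simp [hy1, hy2, hy3, hfr]
    · simp only [Prog.exec, block, Op.apply, Function.update_apply]
      refine ⟨trivial, by simp [h6], by simp [hx12, hx], by simp [h6], ?_⟩
      intro y hy1 hy2 hy3
      simp [hy3]
  refine Within.seq_le 3 (8 * N + 15) (by omega) ?_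
  refine Within.exec rfl (by simp [Prog.cost, block])
    (Within.seq_le (a * (7 + 1) + 1) 3 (by omega) ?_)
  refine (hloop _ rfl).mono le_rfl ?_
  rintro s' ⟨h0, v, j, hj, -, hm, e6, ex, e12, hfr⟩
  -- The bit just read is zero, and all bits of the code before its terminator are nonzero.
  have hja : j = a := by
    by_contra hja
    exact h.1 j (by omega) (e12 ▸ h0)
  subst hja
  refine Within.exec rfl (by simp [Prog.cost, block]) ?_
  have e1 : s'.reg 1 = 1 := by rw [hfr 1 hx1.symm (by decide) (by decide), h1]
  simp only [Prog.exec, block, Op.apply, Function.update_apply]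
  refine ⟨hm, by simp [e6, e1], by simp [hx6, ex], ?_⟩
  intro y hy1 hy2 hy3
  simp [hy2, hfr y hy1 hy2 hy3]

variable (I : BriberyInstance)

/-- The contents of the fixed registers during the main computation. -/
structure Ready (s : Store) : Prop where
  r0 : s.reg 0 = I.encode.length
  r1 : s.reg 1 = 1
  r2 : s.reg 2 = I.m
  r3 : s.reg 3 = I.n
  r4 : s.reg 4 = I.k
  r5 : s.reg 5 = I.l
  r6 : s.reg 6 = I.jBase
  r7 : s.reg 7 = I.voteBase
  r8 : s.reg 8 = I.encode.length + I.n
  r9 : s.reg 9 = I.encode.length + I.n + I.n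
  r11 : s.reg 11 = 0

variable {I}

/-- Register 10 is exempt since it is reserved for the threshold, which is tracked separately.
Register 11 stays zero, so adding it copies a register. -/
theorem Ready.congr {s s' : Store} (h : Ready I s)
    (hs : ∀ y < 12, y ≠ 10 → s'.reg y = s.reg y) : Ready I s' := by
  constructor
  · rw [hs _ (by decide) (by decide), h.r0]
  · rw [hs _ (by decide) (by decide), h.r1]
  · rw [hs _ (by decide) (by decide), h.r2]
  · rw [hs _ (by decide) (by decide), h.r3]
  · rw [hs _ (by decide) (by decide), h.r4]
  · rw [hs _ (by decide) (by decide), h.r5]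
  · rw [hs _ (by decide) (by decide), h.r6]
  · rw [hs _ (by decide) (by decide), h.r7]
  · rw [hs _ (by decide) (by decide), h.r8]
  · rw [hs _ (by decide) (by decide), h.r9]
  · rw [hs _ (by decide) (by decide), h.r11]

theorem m_le_length : I.m ≤ I.encode.length := by
  rw [I.length_encode, BriberyInstance.voteBase]; omega

theorem n_le_length : I.n ≤ I.encode.length := by
  rw [I.length_encode, BriberyInstance.voteBase, BriberyInstance.jBase]; omega

/-- Read the four numbers of the instance and compute the base addresses. -/
def parse : Prog :=
  .seq (block [.const 1 1]) (.seq (readUnary 2) (.seq (readUnary 3) (.seq (readUnary 4)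
    (.seq (readUnary 5) (block [.add 7 6 2, .add 8 0 3, .add 9 8 3])))))

theorem within_parse (P : Prog) :
    Within parse (32 * I.encode.length + 100) (start P I.encode).store fun s =>
      Ready I s ∧ s.mem = I.input ∧ s.reg 10 = 0 ∧ s.reg 24 = 0 := by
  set N := I.encode.length with hN
  have hm : I.m ≤ N := m_le_length
  have hn : I.n ≤ N := n_le_length
  have hk : I.k ≤ N := I.k_le.trans hm
  have hl : I.l ≤ N := I.l_le.trans hn
  refine Within.seq_le 3 (32 * N + 96) (by omega) ?_
  refine Within.exec rfl (by simp [Prog.cost, block])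
    (Within.seq_le (8 * N + 20) (24 * N + 75) (by omega) ?_)
  refine (within_readUnary (p := 0) (by decide) (by decide) (by decide) I.unaryAt_m hm rfl rfl rfl).mono
    le_rfl ?_
  rintro s ⟨m1, a1, b1, f1⟩
  refine Within.seq_le (8 * N + 20) (16 * N + 54) (by omega) ((within_readUnary (s := s) (p := I.m + 1) (a := I.n) (by decide) (by decide)
    (by decide) ?_ hn ?_ ?_ ?_).mono le_rfl ?_)
  · rw [m1]; exact I.unaryAt_n
  · rw [f1 _ (by decide) (by decide) (by decide)]; rfl
  · rw [a1]; omega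
  · rw [f1 _ (by decide) (by decide) (by decide)]; rfl
  rintro s' ⟨m2, a2, b2, f2⟩
  refine Within.seq_le (8 * N + 20) (8 * N + 33) (by omega) ((within_readUnary (s := s') (p := I.m + I.n + 2) (a := I.k) (by decide)
    (by decide) (by decide) ?_ hk ?_ ?_ ?_).mono le_rfl ?_)
  · rw [m2, m1]; exact I.unaryAt_k
  · rw [f2 _ (by decide) (by decide) (by decide), f1 _ (by decide) (by decide) (by decide)]; rfl
  · rw [a2]; omega
  · rw [f2 _ (by decide) (by decide) (by decide), f1 _ (by decide) (by decide) (by decide)]; rfl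
  rintro s'' ⟨m3, a3, b3, f3⟩
  refine Within.seq_le (8 * N + 20) 7 (by omega) ((within_readUnary (s := s'') (p := I.m + I.n + I.k + 3) (a := I.l) (by decide)
    (by decide) (by decide) ?_ hl ?_ ?_ ?_).mono le_rfl ?_)
  · rw [m3, m2, m1]; exact I.unaryAt_l
  · rw [f3 _ (by decide) (by decide) (by decide), f2 _ (by decide) (by decide) (by decide),
      f1 _ (by decide) (by decide) (by decide)]; rfl
  · rw [a3]; omega
  · rw [f3 _ (by decide) (by decide) (by decide), f2 _ (by decide) (by decide) (by decide),
      f1 _ (by decide) (by decide) (by decide)]; rfl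
  rintro s₃ ⟨m4, a4, b4, f4⟩
  have hf : ∀ y, y ≠ 2 → y ≠ 3 → y ≠ 4 → y ≠ 5 → y ≠ 6 → y ≠ 12 → s₃.reg y =
      ((block [.const 1 1]).exec (start P I.encode).store).reg y := by
    intro y h2 h3 h4 h5 h6 h12
    rw [f4 y h5 h6 h12, f3 y h4 h6 h12, f2 y h3 h6 h12, f1 y h2 h6 h12]
  have e0 : s₃.reg 0 = N := hf 0 (by decide) (by decide) (by decide) (by decide) (by decide)
    (by decide)
  have e1 : s₃.reg 1 = 1 := hf 1 (by decide) (by decide) (by decide) (by decide) (by decide)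
    (by decide)
  have e10 : s₃.reg 10 = 0 := hf 10 (by decide) (by decide) (by decide) (by decide) (by decide)
    (by decide)
  have e11 : s₃.reg 11 = 0 := hf 11 (by decide) (by decide) (by decide) (by decide) (by decide)
    (by decide)
  have e24 : s₃.reg 24 = 0 := hf 24 (by decide) (by decide) (by decide) (by decide) (by decide)
    (by decide)
  have e2 : s₃.reg 2 = I.m := by
    rw [f4 _ (by decide) (by decide) (by decide), f3 _ (by decide) (by decide) (by decide),
      f2 _ (by decide) (by decide) (by decide), b1]
  have e3 : s₃.reg 3 = I.n := by
    rw [f4 _ (by decide) (by decide) (by decide), f3 _ (by decide) (by decide) (by decide), b2]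
  have e4 : s₃.reg 4 = I.k := by rw [f4 _ (by decide) (by decide) (by decide), b3]
  have e6 : s₃.reg 6 = I.jBase := by rw [a4, BriberyInstance.jBase]; omega
  refine Within.exec rfl (by simp [Prog.cost, block]) ⟨⟨?_, ?_, ?_, ?_, ?_, ?_, ?_, ?_, ?_, ?_, ?_⟩,
    ?_, ?_, ?_⟩
  case refine_12 => exact m4.trans (m3.trans (m2.trans m1))
  all_goals simp only [Prog.exec, block, Op.apply, Function.update_apply]
  all_goals simp [e0, e1, e2, e3, e4, b4, e6, e10, e11, e24,
    BriberyInstance.voteBase, hN]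

end ApprovalVoting

namespace ApprovalVoting

open RAM

variable {I : BriberyInstance}

/-! ### The numbers of approvals -/

/-- All registers outside `X` are unchanged. -/
def Frame (X : List ℕ) (s s' : Store) : Prop := ∀ y, y ∉ X → s'.reg y = s.reg y

theorem Frame.refl (X : List ℕ) (s : Store) : Frame X s s := fun _ _ => rfl

theorem Frame.ready {X : List ℕ} {s s' : Store} (h : Frame X s s') (hs : Ready I s)
    (hX : ∀ y < 12, y ≠ 10 → y ∉ X) : Ready I s' :=
  hs.congr fun y hy hy' => h y (hX y hy hy')

theorem Frame.trans {X Y Z : List ℕ} {s s' s'' : Store} (h : Frame X s s') (h' : Frame Y s' s'')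
    (hX : X ⊆ Z) (hY : Y ⊆ Z) : Frame Z s s'' :=
  fun y hy => (h' y fun h => hy (hY h)).trans (h y fun h => hy (hX h))

/-- The layout of prices, owners and current scores in memory. -/
structure Layout (I : BriberyInstance) (p o r : ℕ → ℕ) (mem : ℕ → ℕ) : Prop where
  input : ∀ a < I.encode.length, mem a = I.input a
  price : ∀ i < I.n, mem (I.encode.length + i) = p i
  owner : ∀ i < I.n, p i ≠ 0 →
    mem (I.encode.length + I.n + i) = I.encode.length + I.n + I.n + o i
  score : ∀ c < I.m, mem (I.encode.length + I.n + I.n + c) = r c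

theorem Layout.vote {p o r mem : ℕ → ℕ} (h : Layout I p o r mem) {i c : ℕ} (hi : i < I.n)
    (hc : c < I.m) : mem (I.voteBase + c + i * I.m) = (I.voteBit i c).toNat := by
  rw [h.input, ← I.input_voteBase hi hc]
  · congr 1; ring
  · rw [I.length_encode]
    have : (i + 1) * I.m ≤ I.n * I.m := Nat.mul_le_mul_right _ hi
    rw [Nat.add_mul] at this
    omega

theorem Layout.distinguished {p o r mem : ℕ → ℕ} (h : Layout I p o r mem) {c : ℕ}
    (hc : c < I.m) : mem (I.jBase + c) = (I.jBit c).toNat := by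
  rw [h.input, ← I.input_jBase hc]
  rw [I.length_encode, BriberyInstance.voteBase]
  omega

theorem Layout.init : Layout I (fun _ => 0) (fun _ => 0) (fun _ => 0) I.input where
  input _ _ := rfl
  price _ _ := I.input_of_le (by omega)
  owner _ _ h := absurd rfl h
  score _ _ := I.input_of_le (by omega)

theorem Layout.update_score {p o r mem : ℕ → ℕ} (h : Layout I p o r mem) {c : ℕ} (v : ℕ) :
    Layout I p o (Function.update r c v)
      (Function.update mem (I.encode.length + I.n + I.n + c) v) where
  input a ha := by rw [Function.update_of_ne (by omega), h.input a ha]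
  price i hi := by rw [Function.update_of_ne (by omega), h.price i hi]
  owner i hi hp := by rw [Function.update_of_ne (by omega), h.owner i hi hp]
  score c' hc' := by
    by_cases hcc : c' = c
    · subst hcc; simp
    · rw [Function.update_of_ne (by omega), Function.update_of_ne hcc, h.score c' hc']

theorem Layout.sell {p o r mem : ℕ → ℕ} (h : Layout I p o r mem) {i : ℕ} (hi : i < I.n) (c v : ℕ) :
    Layout I (Function.update p i v) (Function.update o i c) r
      (Function.update (Function.update mem (I.encode.length + I.n + i)
        (I.encode.length + I.n + I.n + c)) (I.encode.length + i) v) where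
  input a ha := by
    rw [Function.update_of_ne (by omega), Function.update_of_ne (by omega), h.input a ha]
  price j hj := by
    by_cases hji : j = i
    · subst hji; simp
    · rw [Function.update_of_ne (by omega), Function.update_of_ne (by omega),
        Function.update_of_ne hji, h.price j hj]
  owner j hj hp := by
    rw [Function.update_of_ne (by omega)]
    by_cases hji : j = i
    · subst hji; simp
    · rw [Function.update_of_ne hji] at hp
      rw [Function.update_of_ne (by omega), Function.update_of_ne hji, h.owner j hj hp]
  score c' hc' := by
    rw [Function.update_of_ne (by omega), Function.update_of_ne (by omega), h.score c' hc']

/-- Count in register 17 the votes for the candidate whose bit in the first vote is addressed by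
register 13. -/
def countVotes : Prog :=
  .seq (block [.add 15 3 11, .add 16 13 11, .const 17 0])
    (.loop 15 (.seq (block [.load 18 16]) (.seq (.ite 18 (block [.add 17 17 1]) .skip)
      (block [.add 16 16 2, .sub 15 15 1]))))

/-- There is no multiplication, so the address of the bit of voter `j` is reached by adding `m` once
per round. -/
theorem within_countVotes {s : Store} {p o r : ℕ → ℕ} {c : ℕ} (hs : Ready I s)
    (hl : Layout I p o r s.mem) (hc : c < I.m) (h13 : s.reg 13 = I.voteBase + c) :
    Within countVotes ((I.encode.length + 1) * (40 + 1) + 20) s fun s' =>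
      s'.mem = s.mem ∧ Frame [15, 16, 17, 18] s s' ∧ s'.reg 17 = I.score c := by
  refine Within.seq_le 7 ((I.encode.length + 1) * (40 + 1)) (by omega)
    (Within.exec rfl (by simp [Prog.cost, block]) ?_)
  refine (Within.forLoop n_le_length (fun j s' => s'.mem = s.mem ∧ Frame [15, 16, 17, 18] s s' ∧
    s'.reg 15 = I.n - j ∧ s'.reg 16 = I.voteBase + c + j * I.m ∧
    s'.reg 17 = Nat.count (fun i => I.voteBit i c = true) j) (fun j s' h => h.2.2.1) ?_ ?_).mono
    le_rfl fun s' h => ⟨h.1, h.2.1, h.2.2.2.2⟩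
  · rintro j s' hj ⟨hm, hf, e15, e16, e17⟩
    have hr := hf.ready hs (by decide)
    have hb : s'.mem (I.voteBase + c + j * I.m) = _ := hm ▸ hl.vote hj hc
    refine Within.exec rfl (by simp [Prog.cost, block]) ?_
    have hcnt := Nat.count_succ (fun i => I.voteBit i c = true) j
    cases hv : I.voteBit j c <;> simp only [hv, Bool.toNat_true, Bool.toNat_false] at hb hcnt
    all_goals
      simp only [Prog.exec, block, Op.apply, Function.update_apply]
      simp only [e16, hb, Frame]
      simp [hm, hr.r1, hr.r2, e15, e17, hcnt]
    · refine ⟨fun y h1 h2 h3 h4 => ?_, by omega, by rw [e16]; ring⟩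
      simp [*]; exact hf y (by simp [*])
    · refine ⟨fun y h1 h2 h3 h4 => ?_, by omega, by rw [e16]; ring⟩
      simp [*]; exact hf y (by simp [*])
  · simp only [Prog.exec, block, Op.apply, Function.update_apply, Frame]
    simp [hs.r3, hs.r11, h13]
    intro y h1 h2 h3 h4
    simp [*]

/-- Store the number of approvals of each candidate. -/
def scoreTable : Prog :=
  .seq (block [.add 12 2 11, .add 13 7 11, .add 14 9 11])
    (.loop 12 (.seq countVotes (block [.store 14 17, .add 13 13 1, .add 14 14 1, .sub 12 12 1])))

theorem within_scoreTable {s : Store} (hs : Ready I s) (hm : s.mem = I.input) :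
    Within scoreTable ((I.encode.length + 1) *
      ((I.encode.length + 1) * (40 + 1) + 50 + 1) + 20) s fun s' =>
      (∃ r, (∀ c < I.m, r c = I.score c) ∧ Layout I (fun _ => 0) (fun _ => 0) r s'.mem) ∧
      Frame [12, 13, 14, 15, 16, 17, 18] s s' := by
  refine Within.seq_le 7 ((I.encode.length + 1) * ((I.encode.length + 1) * (40 + 1) + 50 + 1))
    (by omega) (Within.exec rfl (by simp [Prog.cost, block]) ?_)
  refine (Within.forLoop m_le_length (fun j s' =>
    (∃ r, (∀ c < j, r c = I.score c) ∧ Layout I (fun _ => 0) (fun _ => 0) r s'.mem) ∧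
    Frame [12, 13, 14, 15, 16, 17, 18] s s' ∧ s'.reg 12 = I.m - j ∧
    s'.reg 13 = I.voteBase + j ∧ s'.reg 14 = I.encode.length + I.n + I.n + j)
    (fun j s' h => h.2.2.1) ?_ ?_).mono le_rfl fun s' h => ⟨h.1, h.2.1⟩
  · rintro j s' hj ⟨⟨r, hr, hl⟩, hf, e12, e13, e14⟩
    refine Within.seq_le _ 9 (by omega) ((within_countVotes (hf.ready hs (by decide)) hl hj
      e13).mono le_rfl ?_)
    rintro s'' ⟨hm', hf', e17⟩
    have hrd := hf'.ready (hf.ready hs (by decide)) (by decide)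
    rw [← hf' 12 (by decide)] at e12
    rw [← hf' 13 (by decide)] at e13
    rw [← hf' 14 (by decide)] at e14
    refine Within.exec rfl (by simp [Prog.cost, block]) ⟨⟨Function.update r j (I.score j), ?_, ?_⟩, ?_⟩
    · intro c hc
      by_cases hcj : c = j
      · subst hcj; simp
      · rw [Function.update_of_ne hcj, hr c (by omega)]
    · have := hl.update_score (c := j) (I.score j)
      rw [← hm', ← e14, ← e17] at this
      rw [← e17]
      exact this
    · have hff := hf.trans hf' (Z := [12, 13, 14, 15, 16, 17, 18]) (by decide) (by decide)
      simp only [Prog.exec, block, Op.apply, Function.update_apply, Frame]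
      simp [hrd.r1, e12, e13, e14]
      refine ⟨fun y h1 h2 h3 h4 h5 h6 h7 => ?_, by omega, by omega, by omega⟩
      simp [*]; exact hff y (by simp [*])
  · refine ⟨⟨_, by simp, by simpa [Prog.exec, block, Op.apply, hm] using Layout.init⟩, ?_⟩
    simp only [Prog.exec, block, Op.apply, Function.update_apply, Frame]
    simp [hs.r2, hs.r7, hs.r9, hs.r11]
    intro y h1 h2 h3 h4 h5 h6 h7
    simp [*]

/-! ### The threshold -/

/-- Count in register 17 the candidates outside `J` whose score exceeds register 13. -/
def countRivals : Prog :=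
  .seq (block [.add 14 2 11, .add 15 6 11, .add 16 9 11, .const 17 0])
    (.loop 14 (.seq (block [.load 18 15, .load 19 16, .sub 19 19 13])
      (.seq (.ite 18 .skip (.ite 19 (block [.add 17 17 1]) .skip))
        (block [.add 15 15 1, .add 16 16 1, .sub 14 14 1]))))

theorem within_countRivals {s : Store} {p o r : ℕ → ℕ} {t : ℕ} (hs : Ready I s)
    (hl : Layout I p o r s.mem) (hsc : ∀ c < I.m, r c = I.score c) (h13 : s.reg 13 = t) :
    Within countRivals ((I.encode.length + 1) * (40 + 1) + 20) s fun s' =>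
      s'.mem = s.mem ∧ Frame [14, 15, 16, 17, 18, 19] s s' ∧ s'.reg 17 = I.rivals t := by
  refine Within.seq_le 9 ((I.encode.length + 1) * (40 + 1)) (by omega)
    (Within.exec rfl (by simp [Prog.cost, block]) ?_)
  refine (Within.forLoop m_le_length (fun j s' => s'.mem = s.mem ∧
    Frame [14, 15, 16, 17, 18, 19] s s' ∧
    s'.reg 14 = I.m - j ∧ s'.reg 15 = I.jBase + j ∧
    s'.reg 16 = I.encode.length + I.n + I.n + j ∧
    s'.reg 17 = Nat.count (fun c => I.jBit c = false ∧ t < I.score c) j)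
    (fun j s' h => h.2.2.1) ?_ ?_).mono
    le_rfl fun s' h => ⟨h.1, h.2.1, h.2.2.2.2.2⟩
  · rintro j s' hj ⟨hm, hf, e14, e15, e16, e17⟩
    have hr := hf.ready hs (by decide)
    have e13 : s'.reg 13 = t := by rw [hf 13 (by decide), h13]
    have hb : s'.mem (I.jBase + j) = _ := hm ▸ hl.distinguished hj
    have hb' : s'.mem (I.encode.length + I.n + I.n + j) = I.score j := by
      rw [hm, hl.score j hj, hsc j hj]
    refine Within.exec rfl (by simp [Prog.cost, block]) ?_
    have hcnt := Nat.count_succ (fun c => I.jBit c = false ∧ t < I.score c) j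
    -- Comparisons are made by truncated subtraction: the difference is nonzero exactly when the
    -- score exceeds `t`.
    have hd' : I.score j - t = 0 ↔ ¬ t < I.score j := by omega
    by_cases hd : t < I.score j
    all_goals
      simp only [hd, not_true, not_false_iff, iff_true, iff_false] at hd'
      cases hv : I.jBit j <;>
        simp only [hv, Bool.toNat_true, Bool.toNat_false, hd, and_true, and_false, if_true,
          if_false, Bool.true_eq_false] at hb hcnt
      all_goals
        simp only [Prog.exec, block, Op.apply, Function.update_apply]
        simp only [e15, hb, Frame]
        simp [hm, hb', hd', hr.r1, e13, e14, e15, e16, e17, hcnt]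
        refine ⟨fun y h1 h2 h3 h4 h5 h6 => ?_, by omega, by omega, by omega⟩
        simp [*]; exact hf y (by simp [*])
  · simp only [Prog.exec, block, Op.apply, Function.update_apply, Frame]
    simp [hs.r2, hs.r6, hs.r9, hs.r11]
    intro y h1 h2 h3 h4 h5 h6
    simp [*]

/-- Compute the threshold in register 10. -/
def computeThreshold : Prog :=
  .seq (block [.add 12 3 11, .const 13 0])
    (.loop 12 (.seq countRivals (.seq (block [.sub 18 4 17])
      (.seq (.ite 18 .skip (block [.add 10 10 1])) (block [.add 13 13 1, .sub 12 12 1])))))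

theorem within_computeThreshold {s : Store} {p o r : ℕ → ℕ} (hs : Ready I s)
    (hl : Layout I p o r s.mem) (hsc : ∀ c < I.m, r c = I.score c) (h10 : s.reg 10 = 0) :
    Within computeThreshold ((I.encode.length + 1) *
      ((I.encode.length + 1) * (40 + 1) + 50 + 1) + 20) s fun s' =>
      s'.mem = s.mem ∧ Frame [10, 12, 13, 14, 15, 16, 17, 18, 19] s s' ∧
      s'.reg 10 = I.threshold := by
  refine Within.seq_le 5 ((I.encode.length + 1) * ((I.encode.length + 1) * (40 + 1) + 50 + 1))
    (by omega) (Within.exec rfl (by simp [Prog.cost, block]) ?_)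
  refine (Within.forLoop n_le_length (fun j s' => s'.mem = s.mem ∧
    Frame [10, 12, 13, 14, 15, 16, 17, 18, 19] s s' ∧
    s'.reg 12 = I.n - j ∧ s'.reg 13 = j ∧
    s'.reg 10 = Nat.count (fun t => I.k ≤ I.rivals t) j)
    (fun j s' h => h.2.2.1) ?_ ?_).mono
    le_rfl fun s' h => ⟨h.1, h.2.1, h.2.2.2.2⟩
  · rintro j s' hj ⟨hm, hf, e12, e13, e10⟩
    refine Within.seq_le _ 20 (by omega) ((within_countRivals (t := j) (hf.ready hs (by decide))
      (hm ▸ hl) hsc e13).mono le_rfl ?_)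
    rintro s'' ⟨hm', hf', e17⟩
    have hrd := hf'.ready (hf.ready hs (by decide)) (by decide)
    rw [← hf' 10 (by decide)] at e10
    rw [← hf' 12 (by decide)] at e12
    rw [← hf' 13 (by decide)] at e13
    have hff := hf.trans hf' (Z := [10, 12, 13, 14, 15, 16, 17, 18, 19]) (by decide) (by decide)
    refine Within.exec rfl (by simp [Prog.cost, block]) ?_
    have hcnt := Nat.count_succ (fun t => I.k ≤ I.rivals t) j
    by_cases hd : I.k - I.rivals j = 0
    all_goals
      have hd' := hd
      rw [Nat.sub_eq_zero_iff_le] at hd'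
      simp only [hd', if_true, if_false] at hcnt
      simp only [Prog.exec, block, Op.apply, Function.update_apply]
      simp only [hrd.r4, e17, Frame]
      simp [hm, hm', hd, hrd.r1, e12, e13, e10, hcnt]
      refine ⟨fun y h1 h2 h3 h4 h5 h6 h7 h8 h9 => ?_, by omega⟩
      simp [*]; exact hff y (by simp [*])
  · simp only [Prog.exec, block, Op.apply, Function.update_apply, Frame]
    simp [hs.r3, hs.r11, h10]
    intro y h1 h2 h3 h4 h5 h6
    simp [*]

end ApprovalVoting

namespace ApprovalVoting

open RAM

variable {I : BriberyInstance}

/-! ### The auction -/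

/-- Register 20 addresses the score of an unsatisfied distinguished candidate, if there is one. -/
def Found (I : BriberyInstance) (r : ℕ → ℕ) (j x : ℕ) : Prop :=
  (x = 0 ∧ ∀ c < j, I.jBit c = true → r c < I.threshold) ∨
    ∃ c < I.m, x = I.encode.length + I.n + I.n + c ∧ I.jBit c = true ∧ I.threshold ≤ r c

theorem Found.ne_zero {r : ℕ → ℕ} {j x : ℕ} (h : Found I r j x) (hx : x ≠ 0) :
    ∃ c < I.m, x = I.encode.length + I.n + I.n + c ∧ I.jBit c = true ∧ I.threshold ≤ r c :=
  h.resolve_left fun h => hx h.1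

/-- Address 0 can stand for "none", since the score cells lie beyond the input word, which is
nonempty. -/
theorem Found.eq_zero {r : ℕ → ℕ} {j x : ℕ} (h : Found I r j x) (hx : x = 0) :
    ∀ c < j, I.jBit c = true → r c < I.threshold := by
  rcases h with h | ⟨c, hc, h, -⟩
  · exact h.2
  · have := m_le_length (I := I)
    omega

/-- Look for a distinguished candidate whose score is not yet below the threshold. -/
def findUnsatisfied : Prog :=
  .seq (block [.const 20 0, .add 12 2 11, .add 13 6 11, .add 14 9 11])
    (.loop 12 (.seq (block [.load 16 13, .load 17 14, .add 17 17 1, .sub 17 17 10])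
      (.seq (.ite 16 (.ite 17 (block [.add 20 14 11]) .skip) .skip)
        (block [.add 13 13 1, .add 14 14 1, .sub 12 12 1]))))

theorem within_findUnsatisfied {s : Store} {p o r : ℕ → ℕ} (hs : Ready I s)
    (h10 : s.reg 10 = I.threshold) (hl : Layout I p o r s.mem) :
    Within findUnsatisfied ((I.encode.length + 1) * (40 + 1) + 20) s fun s' =>
      s'.mem = s.mem ∧ Frame [12, 13, 14, 16, 17, 20] s s' ∧ Found I r I.m (s'.reg 20) := by
  refine Within.seq_le 9 ((I.encode.length + 1) * (40 + 1)) (by omega)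
    (Within.exec rfl (by simp [Prog.cost, block]) ?_)
  refine (Within.forLoop m_le_length (fun j s' => s'.mem = s.mem ∧
    Frame [12, 13, 14, 16, 17, 20] s s' ∧
    s'.reg 12 = I.m - j ∧ s'.reg 13 = I.jBase + j ∧
    s'.reg 14 = I.encode.length + I.n + I.n + j ∧ Found I r j (s'.reg 20))
    (fun j s' h => h.2.2.1) ?_ ?_).mono
    le_rfl fun s' h => ⟨h.1, h.2.1, h.2.2.2.2.2⟩
  · rintro j s' hj ⟨hm, hf, e12, e13, e14, hfd⟩
    have hr := hf.ready hs (by decide)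
    have e10 : s'.reg 10 = I.threshold := by rw [hf 10 (by decide), h10]
    have hb : s'.mem (I.jBase + j) = _ := hm ▸ hl.distinguished hj
    have hb' : s'.mem (I.encode.length + I.n + I.n + j) = r j := by rw [hm, hl.score j hj]
    -- Adding one before subtracting tests `τ ≤ r j` instead of the strict inequality.
    have hd' : r j + 1 - I.threshold = 0 ↔ ¬ I.threshold ≤ r j := by omega
    have hnext : ¬ (I.jBit j = true ∧ I.threshold ≤ r j) → Found I r (j + 1) (s'.reg 20) := by
      intro h
      rcases hfd with ⟨h0, h1⟩ | h1
      · refine Or.inl ⟨h0, fun c hc hJ => ?_⟩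
        rcases Nat.lt_succ_iff_lt_or_eq.1 hc with hc | rfl
        · exact h1 c hc hJ
        · by_contra hn
          exact h ⟨hJ, not_lt.1 hn⟩
      · exact Or.inr h1
    refine Within.exec rfl (by simp [Prog.cost, block]) ?_
    by_cases hd : I.threshold ≤ r j
    all_goals
      simp only [hd, not_true, not_false_iff, iff_true, iff_false] at hd'
      cases hv : I.jBit j <;>
        simp only [hv, Bool.toNat_true, Bool.toNat_false, hd, and_true, and_false, Bool.false_eq_true, not_false_iff, true_imp_iff, not_true,
          false_imp_iff] at hb hnext
      all_goals
        simp only [Prog.exec, block, Op.apply, Function.update_apply]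
        simp only [e13, hb, Frame]
        simp [hm, hb', hd', hr.r1, hr.r11, e12, e14, e10, e13]
    · refine ⟨fun y h1 h2 h3 h4 h5 h6 => ?_, by omega, by omega, by omega, hnext⟩
      simp [*]; exact hf y (by simp [*])
    · refine ⟨fun y h1 h2 h3 h4 h5 h6 => ?_, by omega, by omega, by omega,
        Or.inr ⟨j, hj, rfl, hv, hd⟩⟩
      simp [*]; exact hf y (by simp [*])
    · refine ⟨fun y h1 h2 h3 h4 h5 h6 => ?_, by omega, by omega, by omega, hnext⟩
      simp [*]; exact hf y (by simp [*])
    · refine ⟨fun y h1 h2 h3 h4 h5 h6 => ?_, by omega, by omega, by omega, hnext⟩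
      simp [*]; exact hf y (by simp [*])
  · simp only [Prog.exec, block, Op.apply, Function.update_apply, Frame]
    simp [hs.r2, hs.r6, hs.r9, hs.r11, Found]
    intro y h1 h2 h3 h4 h5 h6
    simp [*]

/-- Find, for the candidate given by register 20, an approving voter of least price; register 21
receives the price and register 22 the address of the price. -/
def findCheapest : Prog :=
  .seq (block [.sub 13 20 9, .add 13 13 7, .add 12 3 11, .add 14 0 11, .add 21 3 1])
    (.loop 12 (.seq (block [.load 15 13, .load 16 14, .sub 17 21 16])
      (.seq (.ite 15 (.ite 17 (block [.add 21 16 11, .add 22 14 11]) .skip) .skip)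
        (block [.add 13 13 2, .add 14 14 1, .sub 12 12 1]))))

/-- Among the first `j` voters that approve `c`, none is cheaper than `b`, and the price `b` is
either prohibitive or the price of the voter whose price is stored at address `x`. -/
def Cheapest (I : BriberyInstance) (p : ℕ → ℕ) (c j b x : ℕ) : Prop :=
  (∀ i < j, I.voteBit i c = true → b ≤ p i) ∧
    (b = I.n + 1 ∨ ∃ i < I.n, I.voteBit i c = true ∧ b = p i ∧ b ≤ I.n ∧
      x = I.encode.length + i)

/-- The best price starts at the sentinel `n + 1` and is replaced only by a strictly smaller one, so
a chosen voter costs at most `n`. The candidate is recovered from the address of its score by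
subtracting the base in register 9. -/
theorem within_findCheapest {s : Store} {p o r : ℕ → ℕ} {c : ℕ} (hs : Ready I s)
    (hc : c < I.m) (h20 : s.reg 20 = I.encode.length + I.n + I.n + c)
    (hl : Layout I p o r s.mem) :
    Within findCheapest ((I.encode.length + 1) * (40 + 1) + 20) s fun s' =>
      s'.mem = s.mem ∧ Frame [12, 13, 14, 15, 16, 17, 21, 22] s s' ∧
      Cheapest I p c I.n (s'.reg 21) (s'.reg 22) := by
  refine Within.seq_le 11 ((I.encode.length + 1) * (40 + 1)) (by omega)
    (Within.exec rfl (by simp [Prog.cost, block]) ?_)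
  refine (Within.forLoop n_le_length (fun j s' => s'.mem = s.mem ∧
    Frame [12, 13, 14, 15, 16, 17, 21, 22] s s' ∧
    s'.reg 12 = I.n - j ∧ s'.reg 13 = I.voteBase + c + j * I.m ∧
    s'.reg 14 = I.encode.length + j ∧ Cheapest I p c j (s'.reg 21) (s'.reg 22))
    (fun j s' h => h.2.2.1) ?_ ?_).mono
    le_rfl fun s' h => ⟨h.1, h.2.1, h.2.2.2.2.2⟩
  · rintro j s' hj ⟨hm, hf, e12, e13, e14, hch⟩
    have hr := hf.ready hs (by decide)
    have hb : s'.mem (I.voteBase + c + j * I.m) = _ := hm ▸ hl.vote hj hc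
    have hb' : s'.mem (I.encode.length + j) = p j := by rw [hm, hl.price j hj]
    have hd' : s'.reg 21 - p j = 0 ↔ ¬ p j < s'.reg 21 := by omega
    have hle : s'.reg 21 ≤ I.n + 1 := by
      rcases hch.2 with h | ⟨i, -, -, -, h, -⟩ <;> omega
    have hnext : ¬ (I.voteBit j c = true ∧ p j < s'.reg 21) →
        Cheapest I p c (j + 1) (s'.reg 21) (s'.reg 22) := by
      intro h
      refine ⟨fun i hi hv => ?_, hch.2⟩
      rcases Nat.lt_succ_iff_lt_or_eq.1 hi with hi | rfl
      · exact hch.1 i hi hv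
      · by_contra hn
        exact h ⟨hv, not_le.1 hn⟩
    have hnew : I.voteBit j c = true → p j < s'.reg 21 →
        Cheapest I p c (j + 1) (p j) (I.encode.length + j) := by
      intro hv hlt
      refine ⟨fun i hi hv => ?_, Or.inr ⟨j, hj, hv, rfl, by omega, rfl⟩⟩
      rcases Nat.lt_succ_iff_lt_or_eq.1 hi with hi | rfl
      · exact hlt.le.trans (hch.1 i hi hv)
      · exact le_rfl
    refine Within.exec rfl (by simp [Prog.cost, block]) ?_
    by_cases hd : p j < s'.reg 21
    all_goals
      simp only [hd, not_true, not_false_iff, iff_true, iff_false] at hd'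
      cases hv : I.voteBit j c <;>
        simp only [hv, Bool.toNat_true, Bool.toNat_false, hd, and_true, and_false, Bool.false_eq_true, not_false_iff, true_imp_iff, not_true,
          false_imp_iff] at hb hnext hnew
      all_goals
        simp only [Prog.exec, block, Op.apply, Function.update_apply]
        simp only [e13, hb, Frame]
        simp [hm, hb', hd', hr.r1, hr.r2, hr.r11, e12, e14, e13]
        refine ⟨fun y h1 h2 h3 h4 h5 h6 h7 h8 => ?_, by omega, by rw [Nat.add_mul]; omega,
          by omega, by assumption⟩
        simp [*]; exact hf y (by simp [*])
  · simp only [Prog.exec, block, Op.apply, Function.update_apply, Frame]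
    simp [hs.r0, hs.r1, hs.r3, hs.r7, hs.r9, hs.r11, Cheapest, h20]
    refine ⟨fun y h1 h2 h3 h4 h5 h6 h7 h8 => ?_, by omega⟩
    simp [*]

/-- Release the voter given by register 22 from its owner if its price, in register 21, is
positive. -/
def releaseVoter : Prog :=
  .ite 21 (block [.add 23 22 3, .load 25 23, .load 26 25, .add 26 26 1, .store 25 26]) .skip

/-- The owner cell holds the address of the owner's score rather than the owner's number, so the
score is reached by indirect loads. It is meaningful only at a positive price. -/
theorem within_releaseVoter {s : Store} {p o r : ℕ → ℕ} {i : ℕ} (hs : Ready I s) (hi : i < I.n)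
    (h21 : s.reg 21 = p i) (h22 : s.reg 22 = I.encode.length + i) (ho : p i ≠ 0 → o i < I.m)
    (hl : Layout I p o r s.mem) :
    Within releaseVoter 20 s fun s' => Layout I p o (Auction.release p o r i) s'.mem ∧
      Frame [23, 25, 26] s s' := by
  refine Within.exec rfl (by simp [Prog.cost, block, releaseVoter]) ?_
  by_cases h0 : p i = 0
  · simp only [releaseVoter, Prog.exec, h21, h0, if_true, Auction.release]
    exact ⟨hl, Frame.refl _ _⟩
  · simp only [releaseVoter, Prog.exec, h21, h0, if_false, Auction.release]
    have h1 : s.mem (I.encode.length + i + I.n) = I.encode.length + I.n + I.n + o i := by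
      rw [← hl.owner i hi h0]; congr 1; omega
    have h2 := hl.score (o i) (ho h0)
    have h3 := hl.update_score (c := o i) (r (o i) + 1)
    simp only [Prog.exec, block, Op.apply, Function.update_apply, Frame]
    constructor
    · simp only [h22, hs.r3, hs.r1, if_true, if_false, h1, h2, Nat.reduceEqDiff]
      exact h3
    · intro y hy
      simp at hy
      simp [hy]

/-- Sell the voter given by register 22 to the candidate given by register 20. -/
def sellVoter : Prog :=
  block [.load 26 20, .sub 26 26 1, .store 20 26, .add 23 22 3, .store 23 20, .add 21 21 1,
    .store 22 21]

theorem within_sellVoter {s : Store} {p o r : ℕ → ℕ} {i c : ℕ} (hs : Ready I s) (hi : i < I.n)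
    (hc : c < I.m) (h20 : s.reg 20 = I.encode.length + I.n + I.n + c)
    (h21 : s.reg 21 = p i) (h22 : s.reg 22 = I.encode.length + i) (hl : Layout I p o r s.mem) :
    Within sellVoter 20 s fun s' => Layout I (Function.update p i (p i + 1))
      (Function.update o i c) (Function.update r c (r c - 1)) s'.mem ∧
      Frame [21, 23, 26] s s' := by
  refine Within.exec rfl (by simp [Prog.cost, block, sellVoter]) ?_
  have h2 := hl.score c hc
  have h3 := (hl.update_score (c := c) (r c - 1)).sell hi c (p i + 1)
  rw [show I.encode.length + I.n + i = I.encode.length + i + I.n by omega] at h3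
  simp only [sellVoter, Prog.exec, block, Op.apply, Frame]
  constructor
  · simpa [Function.update_apply, h20, h21, h22, hs.r1, hs.r3, h2] using h3
  · intro y hy
    simp at hy
    simp [hy]

/-- The auction; it sets register 24 if a candidate finds no voter at an acceptable price. -/
def auction : Prog :=
  .seq findUnsatisfied (.loop 20 (.seq findCheapest (.seq (block [.add 23 3 1, .sub 23 23 21])
    (.ite 23 (.seq releaseVoter (.seq sellVoter findUnsatisfied))
      (block [.const 24 1, .const 20 0])))))

/-- The invariant of the auction. -/
def AuctionInv (I : BriberyInstance) (v : ℕ) (s : Store) : Prop :=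
  Ready I s ∧ s.reg 10 = I.threshold ∧
    ((s.reg 24 = 1 ∧ s.reg 20 = 0 ∧ ∀ D g, ¬ I.data.IsSolution D g) ∨
    (s.reg 24 = 0 ∧ ∃ p o r, Layout I p o r s.mem ∧ I.data.Inv p o r ∧
      Found I r I.m (s.reg 20) ∧ (∀ i < I.n, p i ≤ I.n + 1) ∧
      v + ∑ i ∈ Finset.range I.n, p i = I.n * (I.n + 1) + 1))

/-- The variant falls because every bid raises the sum of the prices by one. Only voters of price at
most `n` are sold, so this sum never exceeds `n(n+1)`; the extra one in the variant leaves room for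
the round that reports failure. -/
theorem within_auction {s : Store} {r : ℕ → ℕ} (hs : Ready I s) (h10 : s.reg 10 = I.threshold)
    (h24 : s.reg 24 = 0) (hr : ∀ c < I.m, r c = I.score c)
    (hl : Layout I (fun _ => 0) (fun _ => 0) r s.mem) :
    Within auction ((I.encode.length + 1) * (40 + 1) + 20 + ((I.encode.length + 1) *
      (I.encode.length + 1) * (2 * ((I.encode.length + 1) * (40 + 1)) + 120) + 1) + 1) s
      fun s' => s'.reg 20 = 0 ∧ ∃ v, AuctionInv I v s' := by
  set N := I.encode.length with hN
  refine Within.seq_le _ _ le_rfl ((within_findUnsatisfied hs h10 hl).mono le_rfl ?_)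
  rintro s₁ ⟨hm₁, hf₁, hfd₁⟩
  have hbound : I.n * (I.n + 1) + 1 ≤ (N + 1) * (N + 1) := by
    have hn : I.n ≤ N := n_le_length
    have := Nat.mul_le_mul hn (Nat.add_le_add_right hn 1)
    rw [Nat.add_mul, Nat.one_mul]
    omega
  refine (Within.loop (T := 2 * ((N + 1) * (40 + 1)) + 119) (AuctionInv I) ?_
    (v := I.n * (I.n + 1) + 1) ?_).mono ?_ fun _ h => h
  · rintro v s₂ ⟨hrd, e10, h⟩ h20
    obtain ⟨e24, p, o, r, hl, hinv, hfd, hp, hv⟩ := h.resolve_left fun h => h20 h.2.1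
    obtain ⟨c, hc, e20, hJ, hτ⟩ := hfd.ne_zero h20
    refine Within.seq_le ((N + 1) * (40 + 1) + 20) ((N + 1) * (40 + 1) + 98) (by omega)
      ((within_findCheapest hrd hc e20 hl).mono le_rfl ?_)
    rintro s₃ ⟨hm₃, hf₃, hch⟩
    have hrd₃ := hf₃.ready hrd (by decide)
    have e10₃ : s₃.reg 10 = I.threshold := by rw [hf₃ 10 (by decide), e10]
    have e20₃ := (hf₃ 20 (by decide)).trans e20
    have e24₃ := (hf₃ 24 (by decide)).trans e24
    refine Within.seq_le 5 ((N + 1) * (40 + 1) + 92) (by omega)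
      (Within.exec rfl (by simp [Prog.cost, block]) ?_)
    set s₄ := (block [.add 23 3 1, .sub 23 23 21]).exec s₃ with hs₄
    have hf₄ : Frame [23] s₃ s₄ := by
      intro y hy
      simp at hy
      simp [hs₄, Prog.exec, block, Op.apply, hy]
    have e23 : s₄.reg 23 = I.n + 1 - s₃.reg 21 := by
      simp [hs₄, Prog.exec, block, Op.apply, hrd₃.r1, hrd₃.r3]
    have hm₄ : s₄.mem = s₃.mem := rfl
    have hrd₄ := hf₄.ready hrd₃ (by decide)
    have e10₄ := (hf₄ 10 (by decide)).trans e10₃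
    have e20₄ := (hf₄ 20 (by decide)).trans e20₃
    have e24₄ := (hf₄ 24 (by decide)).trans e24₃
    clear_value s₄
    refine Within.ite (t := (N + 1) * (40 + 1) + 91) (fun h23 => ?_) fun h23 => ?_
    · obtain ⟨i, hi, hA, e21, hle, e22⟩ := hch.2.resolve_left fun h => h23 (by omega)
      have e21₄ := (hf₄ 21 (by decide)).trans e21
      have e22₄ := (hf₄ 22 (by decide)).trans e22
      refine Within.seq_le 20 ((N + 1) * (40 + 1) + 70) (by omega) ((within_releaseVoter (r := r)
        (o := o) hrd₄ hi e21₄ e22₄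
        (fun h0 => I.lt_of_jBit (hinv.owner i hi h0).2) (by rwa [hm₄, hm₃])).mono le_rfl ?_)
      rintro s₅ ⟨hl₅, hf₅⟩
      have hrd₅ := hf₅.ready hrd₄ (by decide)
      refine Within.seq_le 20 ((N + 1) * (40 + 1) + 20) (by omega) ((within_sellVoter hrd₅ hi hc
        ((hf₅ 20 (by decide)).trans e20₄) ((hf₅ 21 (by decide)).trans e21₄)
        ((hf₅ 22 (by decide)).trans e22₄) hl₅).mono le_rfl ?_)
      rintro s₆ ⟨hl₆, hf₆⟩
      have hrd₆ := hf₆.ready hrd₅ (by decide)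
      have hff := hf₅.trans hf₆ (Z := [21, 23, 25, 26]) (by decide) (by decide)
      have e10₆ := (hff 10 (by decide)).trans e10₄
      have e24₆ := (hff 24 (by decide)).trans e24₄
      refine (within_findUnsatisfied hrd₆ e10₆ hl₆).mono le_rfl ?_
      rintro s₇ ⟨hm₇, hf₇, hfd₇⟩
      have hmem : i ∈ Finset.range I.n := Finset.mem_range.2 hi
      have hsum : ∑ j ∈ Finset.range I.n, Function.update p i (p i + 1) j =
          ∑ j ∈ Finset.range I.n, p j + 1 := by
        rw [Finset.sum_update_of_mem hmem, ← Finset.sum_sdiff (Finset.singleton_subset_iff.2 hmem),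
          Finset.sum_singleton]
        ring
      have hp' : ∀ j < I.n, Function.update p i (p i + 1) j ≤ I.n + 1 := by
        intro j hj
        by_cases hji : j = i
        · subst hji; rw [Function.update_self]; omega
        · rw [Function.update_of_ne hji]; exact hp j hj
      have hle' : ∑ j ∈ Finset.range I.n, Function.update p i (p i + 1) j ≤ I.n * (I.n + 1) := by
        have := Finset.sum_le_card_nsmul (Finset.range I.n) _ _
          fun j hj => hp' j (Finset.mem_range.1 hj)
        simpa using this
      refine ⟨v - 1, by omega, hf₇.ready hrd₆ (by decide), (hf₇ 10 (by decide)).trans e10₆,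
        Or.inr ⟨(hf₇ 24 (by decide)).trans e24₆, _, _, _, hm₇ ▸ hl₆, ?_, hfd₇, hp', by omega⟩⟩
      refine hinv.bid ?_ hJ hτ hi hA fun j hj hAj => e21 ▸ hch.1 j hj hAj
      intro S hS hSA
      change _ ≤ Nat.count _ _
      rw [Nat.count_eq_card_filter_range]
      exact Finset.card_le_card fun j hj => Finset.mem_filter.2 ⟨hS hj, hSA j hj⟩
    · have hle : ∑ j ∈ Finset.range I.n, p j ≤ I.n * (I.n + 1) := by
        have := Finset.sum_le_card_nsmul (Finset.range I.n) _ _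
          fun j hj => hp j (Finset.mem_range.1 hj)
        simpa using this
      have hf₅ : Frame [24, 20] s₄ ((block [.const 24 1, .const 20 0]).exec s₄) := by
        intro y hy
        simp at hy
        simp [Prog.exec, block, Op.apply, hy]
      -- By `hle` the variant is still positive here, so the failure state can take variant 0.
      refine Within.exec rfl (by simp [Prog.cost, block]) ⟨0, by omega,
        hf₅.ready hrd₄ (by decide), (hf₅ 10 (by decide)).trans e10₄, Or.inl ⟨?_, ?_, ?_⟩⟩
      · simp [Prog.exec, block, Op.apply]
      · simp [Prog.exec, block, Op.apply]
      · refine hinv.no_solution hJ hτ fun j hj hA => ?_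
        have := hch.1 j hj hA
        change I.n < p j
        omega
  · refine ⟨hf₁.ready hs (by decide), (hf₁ 10 (by decide)).trans h10,
      Or.inr ⟨(hf₁ 24 (by decide)).trans h24, _, _, r, hm₁ ▸ hl, ?_, hfd₁, by simp, by simp⟩⟩
    exact Auction.Data.Inv.init r fun c hc => hr c (I.lt_of_jBit hc)
  · exact Nat.add_le_add_right (Nat.mul_le_mul_right _ hbound) 1

/-! ### The whole program -/

/-- Count the sold voters in register 14. -/
def countSold : Prog :=
  .seq (block [.add 12 3 11, .add 13 0 11, .const 14 0])
    (.loop 12 (.seq (block [.load 15 13]) (.seq (.ite 15 (block [.add 14 14 1]) .skip)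
      (block [.add 13 13 1, .sub 12 12 1]))))

theorem within_countSold {s : Store} {p o r : ℕ → ℕ} (hs : Ready I s)
    (hl : Layout I p o r s.mem) :
    Within countSold ((I.encode.length + 1) * (40 + 1) + 20) s fun s' =>
      Frame [12, 13, 14, 15] s s' ∧ s'.reg 14 = (I.data.sold p).card := by
  refine Within.seq_le 7 ((I.encode.length + 1) * (40 + 1)) (by omega)
    (Within.exec rfl (by simp [Prog.cost, block]) ?_)
  refine (Within.forLoop n_le_length (fun j s' => s'.mem = s.mem ∧
    Frame [12, 13, 14, 15] s s' ∧
    s'.reg 12 = I.n - j ∧ s'.reg 13 = I.encode.length + j ∧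
    s'.reg 14 = Nat.count (fun i => p i ≠ 0) j)
    (fun j s' h => h.2.2.1) ?_ ?_).mono
    le_rfl fun s' h => ⟨h.2.1, ?_⟩
  · rintro j s' hj ⟨hm, hf, e12, e13, e14⟩
    have hr := hf.ready hs (by decide)
    have hb : s'.mem (I.encode.length + j) = p j := by rw [hm, hl.price j hj]
    refine Within.exec rfl (by simp [Prog.cost, block]) ?_
    have hcnt := Nat.count_succ (fun i => p i ≠ 0) j
    by_cases hd : p j = 0
    all_goals
      simp only [hd, ne_eq, not_true, not_false_iff, if_true, if_false] at hcnt
      simp only [Prog.exec, block, Op.apply, Function.update_apply]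
      simp only [e13, hb, Frame]
      simp [hm, hd, hr.r1, e12, e14, hcnt, e13]
      refine ⟨fun y h1 h2 h3 h4 => ?_, by omega, by omega⟩
      simp [*]; exact hf y (by simp [*])
  · simp only [Prog.exec, block, Op.apply, Function.update_apply, Frame]
    simp [hs.r0, hs.r3, hs.r11]
    intro y h1 h2 h3 h4
    simp [*]
  · rw [h.2.2.2.2, Nat.count_eq_card_filter_range]
    rfl

/-- The decision procedure. -/
def decideBribery : Prog :=
  .seq parse (.seq scoreTable (.seq computeThreshold (.seq auction
    (.ite 24 (block [.const 0 0]) (.seq countSold (block [.add 0 5 1, .sub 0 0 14]))))))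

/-- The number of steps of `decideBribery` on words of length `N`. -/
noncomputable def timeBound : Polynomial ℕ :=
  let N : Polynomial ℕ := Polynomial.X
  2 * ((N + 1) * ((N + 1) * 41 + 51) + 20) + (N + 1) * (N + 1) * (2 * ((N + 1) * 41) + 120) +
    2 * ((N + 1) * 41 + 20) + 32 * N + 200

theorem within_decideBribery (I : BriberyInstance) :
    Within decideBribery (timeBound.eval I.encode.length) (start decideBribery I.encode).store
      fun s => s.reg 0 ≠ 0 ↔ IsYesVDC 1 I := by
  set N := I.encode.length with hN
  -- Naming the nonlinear terms makes the budget arithmetic linear.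
  set A := (N + 1) * ((N + 1) * 41 + 51) with hA
  set B := (N + 1) * (N + 1) * (2 * ((N + 1) * 41) + 120) with hB
  set C := (N + 1) * 41 with hC
  have ht : timeBound.eval N = 2 * (A + 20) + B + 2 * (C + 20) + 32 * N + 200 := by
    simp [timeBound, hA, hB, hC]
  rw [ht]
  refine Within.seq_le (32 * N + 100) (2 * (A + 20) + B + 2 * (C + 20) + 99) (by omega)
    ((within_parse _).mono le_rfl ?_)
  rintro s₁ ⟨hs₁, hm₁, e10, e24⟩
  refine Within.seq_le (A + 20) (A + 20 + B + 2 * (C + 20) + 90) (by omega)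
    ((within_scoreTable hs₁ hm₁).mono le_rfl ?_)
  rintro s₂ ⟨⟨r, hr, hl₂⟩, hf₂⟩
  have hs₂ := hf₂.ready hs₁ (by decide)
  refine Within.seq_le (A + 20) (B + 2 * (C + 20) + 80) (by omega)
    ((within_computeThreshold hs₂ hl₂ hr ((hf₂ 10 (by decide)).trans e10)).mono le_rfl ?_)
  rintro s₃ ⟨hm₃, hf₃, e10₃⟩
  have hs₃ := hf₃.ready hs₂ (by decide)
  have e24₃ := (hf₃ 24 (by decide)).trans ((hf₂ 24 (by decide)).trans e24)
  refine Within.seq_le (C + 20 + (B + 1) + 1) (C + 60) (by omega)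
    ((within_auction hs₃ e10₃ e24₃ hr (hm₃ ▸ hl₂)).mono le_rfl ?_)
  rintro s₄ ⟨e20, v, hs₄, e10₄, h⟩
  refine Within.ite (t := C + 59) (fun h24 => ?_) fun h24 => ?_
  · rcases h with ⟨-, -, hno⟩ | h
    · refine Within.exec rfl (by simp [Prog.cost, block]) ?_
      rw [I.isYes_iff]
      simp [Prog.exec, block, Op.apply, hno]
    · exact absurd h.1 h24
  · rcases h with h | ⟨-, p, o, r', hl₄, hinv, hfd, -⟩
    · omega
    · refine Within.seq_le (C + 20) 5 (by omega) ((within_countSold hs₄ hl₄).mono le_rfl ?_)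
      rintro s₅ ⟨hf₅, e14⟩
      have hs₅ := hf₅.ready hs₄ (by decide)
      refine Within.exec rfl (by simp [Prog.cost, block]) ?_
      -- The added one makes the result nonzero exactly when at most `l` voters are sold.
      have e0 : ((block [.add 0 5 1, .sub 0 0 14]).exec s₅).reg 0 =
          I.l + 1 - (I.data.sold p).card := by
        simp [Prog.exec, block, Op.apply, hs₅.r5, hs₅.r1, e14]
      rw [e0, I.isYes_iff]
      constructor
      · intro h
        exact ⟨_, _, hinv.isSolution fun c hc => hfd.eq_zero e20 c (I.lt_of_jBit hc) hc, by omega⟩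
      · rintro ⟨D, g, hD, hcard⟩
        have := hinv.card_sold_le hD
        omega

end ApprovalVoting

theorem mainTheorem6 :
    RAM.SolvableInPolyTime ApprovalVoting.BriberyInstance.encode
      (ApprovalVoting.IsYesVDC 1) :=
  RAM.SolvableInPolyTime.of_within _ _ ApprovalVoting.within_decideBribery
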